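/- For non-negative integers $a,b$ let $R_{a,b}=\{1,\dots,a\}\times\{1,\dots,b\}\subset\mathbb{Z}\times\mathbb{Z}$ be the rectangle of width $a$ and height $b$. A domino is a set of the form $\{(i,j),(i+1,j)\}$ (horizontal) or $\{(i,j),(i,j+1)\}$ (vertical). A domino tiling of $R_{a,b}$ is a set $D$ of dominoes contained in $R_{a,b}$ such that every element of $R_{a,b}$ lies in exactly one element of $D$. Let $\mathrm{D}(R_{a,b})$ be the set of all domino tilings of $R_{a,b}$ (for an empty rectangle it consists of the empty tiling only), let $h(D)$ be the number of horizontal dominoes in $D$, and set $$S_{a,b}=\sum_{D\in\mathrm{D}(R_{a,b})}\sqrt{-1}^{\,h(D)}\in\mathbb{C}.$$ Theorem. Let $m,n$ be positive integers with $n$ odd. Then $$S_{m-1,n-1}=\begin{cases}\left(\dfrac{m}{n}\right)&\text{if } m \text{ is odd},\\[2ex]\left(\dfrac{m/2}{n}\right)&\text{if } m \text{ is even},\end{cases}$$ where the right-hand side is the Jacobi symbol. In particular $S_{m-1,n-1}\in\{-1,0,1\}$. Moreover, if $m$ and $n$ are both odd, then $$S_{m-1,n-1}=(-1)^{\frac{m-1}{2}\frac{n-1}{2}}\,S_{n-1,m-1}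 \quad\text{and}\quad \left(\frac{m}{n}\right)=(-1)^{\frac{m-1}{2}\frac{n-1}{2}}\left(\frac{n}{m}\right).$$ -/

import Mathlib

namespace DominoTilings

/-- A square is a point of `ℤ × ℤ`; a board is a finite set of squares. -/
abbrev Board : Type := Finset (ℤ × ℤ)

/-- The rectangle of width `m` and height `n`, i.e. `{1, …, m} × {1, …, n}`. -/
noncomputable def rect (m n : ℕ) : Board :=
  Finset.Icc (1 : ℤ) (m : ℤ) ×ˢ Finset.Icc (1 : ℤ) (n : ℤ)

/-- Two horizontally adjacent squares. -/
def IsHorizontal (d : Finset (ℤ × ℤ)) : Prop :=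
  ∃ i j : ℤ, d = {(i, j), (i + 1, j)}

/-- Two vertically adjacent squares. -/
def IsVertical (d : Finset (ℤ × ℤ)) : Prop :=
  ∃ i j : ℤ, d = {(i, j), (i, j + 1)}

/-- A domino tiling of `X` is a set of subsets of `X`, each consisting of two adjacent squares,
such that every square of `X` lies in exactly one of them. -/
def IsDominoTiling (X : Board) (D : Finset (Finset (ℤ × ℤ))) : Prop :=
  (∀ d ∈ D, d ⊆ X ∧ (IsHorizontal d ∨ IsVertical d)) ∧
  (∀ s ∈ X, ∃! d, d ∈ D ∧ s ∈ d)

open Classical in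
/-- The finite set of all domino tilings of the board `X`. -/
noncomputable def dominoTilings (X : Board) : Finset (Finset (Finset (ℤ × ℤ))) :=
  X.powerset.powerset.filter (fun D => IsDominoTiling X D)

open Classical in
/-- The number of horizontal dominoes of `D`. -/
noncomputable def numHorizontal (D : Finset (Finset (ℤ × ℤ))) : ℕ :=
  (D.filter (fun d => IsHorizontal d)).card

/-- The powerset restriction in `dominoTilings` loses no tiling. -/
theorem mem_dominoTilings {X : Board} {D : Finset (Finset (ℤ × ℤ))} :
    D ∈ dominoTilings X ↔ IsDominoTiling X D := by
  simp only [dominoTilings, Finset.mem_filter, Finset.mem_powerset, and_iff_right_iff_imp]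
  intro h d hd
  exact Finset.mem_powerset.2 (h.1 d hd).1

/-- The sum of `√-1 ^ h(D)` over all domino tilings `D` of the board `X`. -/
noncomputable def signedTilingSum (X : Board) : ℂ :=
  ∑ D ∈ dominoTilings X, Complex.I ^ numHorizontal D

end DominoTilings

/-! ### Domino tilings and expansion at a corner square -/

namespace DominoTilings

/-! Strip a board of width b row by row, recording which squares of the next row are already covered
by vertical dominoes from above. This gives an operator T = `transfer y b 1` on functions of
configurations of two-state sites, and the tiling sum of a rows with weight `y` per horizontal
domino is the vacuum entry of T^a (`amplitude_eq_weightedTilingSum`).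

After a Jordan–Wigner transformation, moving a fermion past T is linear (`ann_mul_transfer`,
`cre_mul_transfer`). If y² = -1, rescaled conjugates of the annihilation operators by powers of T
solve the discrete wave equation with Dirichlet conditions at 0 and b + 1. After b + 1 time steps a
solution is reflected, up to sign (`wave_reflection`), so T^(b+1) maps the vacuum to c times the
vacuum (`transfer_pow_vacuum`). Together with T⁻¹ = X T' X, where X flips all sites and T' has
weight -y, this yields: adding b + 1 rows multiplies the amplitude by c; a ↦ b - 1 - a preserves it
up to c and y ↦ -y; it vanishes at a = b > 0.

For b = 2N and n = 2N + 1, transposition turns these into c² = 1, a period 2n in the numerator of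
the Jacobi symbol, the factor (-1/n) under negation, and a zero at equal arguments. With the
diagonal symmetry, whose sign is that of quadratic reciprocity, these are the rules by which
Euclid's algorithm computes the symbol. Reciprocity itself is taken from
`jacobiSym.quadratic_reciprocity`, not deduced from tilings. Odd widths reduce to even ones by a
shift by n, and the width-one board, with sum 1, identifies c as (2/n). -/

/-- The sum of `y ^ h(D)` over all domino tilings `D` of the board `X`. -/
noncomputable def weightedTilingSum (y : ℂ) (X : Board) : ℂ :=
  ∑ D ∈ dominoTilings X, y ^ numHorizontal D

theorem not_isHorizontal_of_isVertical {d : Finset (ℤ × ℤ)} (hv : IsVertical d) :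
    ¬ IsHorizontal d := by
  rintro ⟨i, j, h⟩
  obtain ⟨k, l, rfl⟩ := hv
  have h1 : ((k, l) : ℤ × ℤ) ∈ ({(i, j), (i + 1, j)} : Finset (ℤ × ℤ)) := by rw [← h]; simp
  have h2 : ((k, l + 1) : ℤ × ℤ) ∈ ({(i, j), (i + 1, j)} : Finset (ℤ × ℤ)) := by rw [← h]; simp
  simp only [Finset.mem_insert, Finset.mem_singleton, Prod.mk.injEq] at h1 h2
  omega

theorem isHorizontal_or_isVertical_nonempty {d : Finset (ℤ × ℤ)}
    (h : IsHorizontal d ∨ IsVertical d) : d.Nonempty := by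
  rcases h with ⟨i, j, rfl⟩ | ⟨i, j, rfl⟩ <;> simp

theorem isHorizontal_or_isVertical_card {d : Finset (ℤ × ℤ)}
    (h : IsHorizontal d ∨ IsVertical d) : d.card = 2 := by
  rcases h with ⟨i, j, rfl⟩ | ⟨i, j, rfl⟩ <;> rw [Finset.card_pair] <;> simp

theorem IsDominoTiling.eq_of_mem {X : Board} {D : Finset (Finset (ℤ × ℤ))}
    (hD : IsDominoTiling X D) {d e : Finset (ℤ × ℤ)} (hd : d ∈ D) (he : e ∈ D) {s : ℤ × ℤ}
    (hsd : s ∈ d) (hse : s ∈ e) : d = e :=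
  (hD.2 s ((hD.1 d hd).1 hsd)).unique ⟨hd, hsd⟩ ⟨he, hse⟩

theorem IsDominoTiling.erase {X : Board} {D : Finset (Finset (ℤ × ℤ))}
    (hD : IsDominoTiling X D) {d : Finset (ℤ × ℤ)} (hd : d ∈ D) :
    IsDominoTiling (X \ d) (D.erase d) := by
  refine ⟨fun e he => ?_, fun s hs => ?_⟩
  · obtain ⟨hne, he⟩ := Finset.mem_erase.1 he
    refine ⟨fun s hs => Finset.mem_sdiff.2 ⟨(hD.1 e he).1 hs, fun hsd => ?_⟩, (hD.1 e he).2⟩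
    exact hne (hD.eq_of_mem he hd hs hsd)
  · obtain ⟨hsX, hsd⟩ := Finset.mem_sdiff.1 hs
    obtain ⟨e, ⟨he, hse⟩, -⟩ := hD.2 s hsX
    refine ⟨e, ⟨Finset.mem_erase.2 ⟨?_, he⟩, hse⟩, ?_⟩
    · rintro rfl
      exact hsd hse
    · rintro e' ⟨he', hse'⟩
      exact hD.eq_of_mem (Finset.mem_of_mem_erase he') he hse' hse

theorem IsDominoTiling.insert {X : Board} {D : Finset (Finset (ℤ × ℤ))} {d : Finset (ℤ × ℤ)}
    (hD : IsDominoTiling (X \ d) D) (hdX : d ⊆ X) (hd : IsHorizontal d ∨ IsVertical d) :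
    IsDominoTiling X (insert d D) := by
  refine ⟨fun e he => ?_, fun s hs => ?_⟩
  · rcases Finset.mem_insert.1 he with rfl | he
    · exact ⟨hdX, hd⟩
    · exact ⟨(hD.1 e he).1.trans Finset.sdiff_subset, (hD.1 e he).2⟩
  · by_cases hsd : s ∈ d
    · refine ⟨d, ⟨Finset.mem_insert_self _ _, hsd⟩, ?_⟩
      rintro e ⟨he, hse⟩
      rcases Finset.mem_insert.1 he with rfl | he
      · rfl
      · exact absurd hsd (Finset.mem_sdiff.1 ((hD.1 e he).1 hse)).2
    · obtain ⟨e, ⟨he, hse⟩, hu⟩ := hD.2 s (Finset.mem_sdiff.2 ⟨hs, hsd⟩)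
      refine ⟨e, ⟨Finset.mem_insert_of_mem he, hse⟩, ?_⟩
      rintro e' ⟨he', hse'⟩
      rcases Finset.mem_insert.1 he' with rfl | he'
      · exact absurd hse' hsd
      · exact hu e' ⟨he', hse'⟩

theorem IsDominoTiling.notMem_of_sdiff {X : Board} {D : Finset (Finset (ℤ × ℤ))}
    {d : Finset (ℤ × ℤ)} (hD : IsDominoTiling (X \ d) D) (hd : IsHorizontal d ∨ IsVertical d) :
    d ∉ D := by
  intro h
  obtain ⟨s, hs⟩ := isHorizontal_or_isVertical_nonempty hd
  exact (Finset.mem_sdiff.1 ((hD.1 d h).1 hs)).2 hs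

-- Deleting `d` is a bijection onto the tilings of `X \ d`, and costs a factor `y` exactly when `d`
-- is horizontal.
open Classical in
theorem sum_tilings_containing (y : ℂ) {X : Board} {d : Finset (ℤ × ℤ)} (hdX : d ⊆ X)
    (hd : IsHorizontal d ∨ IsVertical d) :
    ∑ D ∈ (dominoTilings X).filter (fun D => d ∈ D), y ^ numHorizontal D =
      (if IsHorizontal d then y else 1) * weightedTilingSum y (X \ d) := by
  rw [weightedTilingSum, Finset.mul_sum]
  refine Finset.sum_bij' (fun D _ => D.erase d) (fun D _ => insert d D) ?_ ?_ ?_ ?_ ?_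
  · intro D hD
    obtain ⟨hD, hdD⟩ := Finset.mem_filter.1 hD
    exact mem_dominoTilings.2 ((mem_dominoTilings.1 hD).erase hdD)
  · intro D hD
    exact Finset.mem_filter.2 ⟨mem_dominoTilings.2 ((mem_dominoTilings.1 hD).insert hdX hd),
      Finset.mem_insert_self _ _⟩
  · intro D hD
    exact Finset.insert_erase (Finset.mem_filter.1 hD).2
  · intro D hD
    exact Finset.erase_insert ((mem_dominoTilings.1 hD).notMem_of_sdiff hd)
  · intro D hD
    have hdD := (Finset.mem_filter.1 hD).2
    conv_lhs => rw [← Finset.insert_erase hdD]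
    rw [numHorizontal, Finset.filter_insert]
    split_ifs with h
    · rw [Finset.card_insert_of_notMem (by simp), pow_succ']
      rfl
    · rw [one_mul]
      rfl

theorem domino_eq_of_mem {X : Board} {D : Finset (Finset (ℤ × ℤ))} (hD : IsDominoTiling X D)
    {i j : ℤ} (hl : (i - 1, j) ∉ X) (hu : (i, j + 1) ∉ X) {d : Finset (ℤ × ℤ)} (hd : d ∈ D)
    (hs : (i, j) ∈ d) : d = {(i, j), (i + 1, j)} ∨ d = {(i, j - 1), (i, j)} := by
  obtain ⟨hdX, h⟩ := hD.1 d hd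
  rcases h with ⟨k, l, rfl⟩ | ⟨k, l, rfl⟩
  · simp only [Finset.mem_insert, Finset.mem_singleton, Prod.mk.injEq] at hs
    rcases hs with ⟨rfl, rfl⟩ | ⟨rfl, rfl⟩
    · exact Or.inl rfl
    · refine absurd (hdX ?_) hl
      simp
  · simp only [Finset.mem_insert, Finset.mem_singleton, Prod.mk.injEq] at hs
    rcases hs with ⟨rfl, rfl⟩ | ⟨rfl, rfl⟩
    · refine absurd (hdX ?_) hu
      simp
    · right
      simp

theorem isHorizontal_pair (i j : ℤ) : IsHorizontal {(i, j), (i + 1, j)} := ⟨i, j, rfl⟩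

theorem isVertical_pair (i j : ℤ) : IsVertical {(i, j - 1), (i, j)} := ⟨i, j - 1, by simp⟩

/-- Expansion at a square without left and upper neighbours. -/
theorem weightedTilingSum_expand (y : ℂ) {X : Board} {i j : ℤ} (hs : (i, j) ∈ X)
    (hl : (i - 1, j) ∉ X) (hu : (i, j + 1) ∉ X) :
    weightedTilingSum y X =
      (if (i + 1, j) ∈ X then y * weightedTilingSum y (X \ {(i, j), (i + 1, j)}) else 0) +
      (if (i, j - 1) ∈ X then weightedTilingSum y (X \ {(i, j - 1), (i, j)}) else 0) := by
  classical
  have hne : ({(i, j), (i + 1, j)} : Finset (ℤ × ℤ)) ≠ {(i, j - 1), (i, j)} := fun h =>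
    not_isHorizontal_of_isVertical (isVertical_pair i j) (h ▸ isHorizontal_pair i j)
  have hsplit : dominoTilings X =
      (dominoTilings X).filter (fun D => {(i, j), (i + 1, j)} ∈ D) ∪
      (dominoTilings X).filter (fun D => {(i, j - 1), (i, j)} ∈ D) := by
    ext D
    simp only [Finset.mem_union, Finset.mem_filter, ← and_or_left]
    refine ⟨fun hD => ⟨hD, ?_⟩, fun h => h.1⟩
    obtain ⟨d, ⟨hd, hsd⟩, -⟩ := (mem_dominoTilings.1 hD).2 _ hs
    rcases domino_eq_of_mem (mem_dominoTilings.1 hD) hl hu hd hsd with rfl | rfl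
    · exact Or.inl hd
    · exact Or.inr hd
  have hdisj : Disjoint ((dominoTilings X).filter (fun D => {(i, j), (i + 1, j)} ∈ D))
      ((dominoTilings X).filter (fun D => {(i, j - 1), (i, j)} ∈ D)) := by
    rw [Finset.disjoint_left]
    intro D h1 h2
    obtain ⟨hD, h1⟩ := Finset.mem_filter.1 h1
    exact hne ((mem_dominoTilings.1 hD).eq_of_mem h1 (Finset.mem_filter.1 h2).2 (s := (i, j))
      (by simp) (by simp))
  have hempty : ∀ (d : Finset (ℤ × ℤ)) (t : ℤ × ℤ), t ∈ d → t ∉ X →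
      ∑ D ∈ (dominoTilings X).filter (fun D => d ∈ D), y ^ numHorizontal D = 0 := by
    intro d t htd htX
    rw [Finset.filter_false_of_mem, Finset.sum_empty]
    intro D hD hdD
    exact htX (((mem_dominoTilings.1 hD).1 d hdD).1 htd)
  rw [weightedTilingSum, hsplit, Finset.sum_union hdisj]
  congr 1
  · split_ifs with h
    · rw [sum_tilings_containing y _ (Or.inl (isHorizontal_pair i j)),
        if_pos (isHorizontal_pair i j)]
      simp [Finset.insert_subset_iff, hs, h]
    · exact hempty _ _ (by simp) h
  · split_ifs with h
    · rw [sum_tilings_containing y _ (Or.inr (isVertical_pair i j)),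
        if_neg (not_isHorizontal_of_isVertical (isVertical_pair i j)), one_mul]
      simp [Finset.insert_subset_iff, hs, h]
    · exact hempty _ _ (by simp) h

theorem dominoTilings_empty : dominoTilings ∅ = {∅} := by
  ext D
  rw [mem_dominoTilings, Finset.mem_singleton]
  refine ⟨fun h => Finset.eq_empty_of_forall_notMem fun d hd => ?_, ?_⟩
  · obtain ⟨s, hs⟩ := isHorizontal_or_isVertical_nonempty (h.1 d hd).2
    simpa using (h.1 d hd).1 hs
  · rintro rfl
    exact ⟨by simp, by simp⟩

theorem weightedTilingSum_empty (y : ℂ) : weightedTilingSum y ∅ = 1 := by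
  simp [weightedTilingSum, dominoTilings_empty, numHorizontal]

theorem mem_rect {a b : ℕ} {i j : ℤ} :
    (i, j) ∈ rect a b ↔ (1 ≤ i ∧ i ≤ a) ∧ 1 ≤ j ∧ j ≤ b := by
  simp [rect]

theorem weightedTilingSum_rect_zero_right (y : ℂ) (a : ℕ) :
    weightedTilingSum y (rect a 0) = 1 := by
  have : rect a 0 = ∅ := by simp [rect]
  rw [this, weightedTilingSum_empty]

theorem weightedTilingSum_column (y : ℂ) (k : ℕ) :
    weightedTilingSum y (rect 1 (2 * k)) = 1 := by
  induction k with
  | zero => exact weightedTilingSum_rect_zero_right y 1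
  | succ k ih =>
    have mem : ∀ i j : ℤ, (i, j) ∈ rect 1 (2 * (k + 1)) ↔
        (1 ≤ i ∧ i ≤ 1) ∧ 1 ≤ j ∧ j ≤ 2 * (k + 1) := by
      simp [mem_rect]
    rw [weightedTilingSum_expand y (i := 1) (j := 2 * k + 2) ((mem _ _).2 (by omega))
      (fun h => by have := (mem _ _).1 h; omega) (fun h => by have := (mem _ _).1 h; omega),
      if_neg (fun h => by have := (mem _ _).1 h; omega), if_pos ((mem _ _).2 (by omega)),
      zero_add, ← ih]
    congr 1
    ext ⟨i, j⟩
    simp only [Finset.mem_sdiff, mem, mem_rect, Finset.mem_insert, Finset.mem_singleton,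
      Prod.mk.injEq]
    push_cast
    omega

/-! ### Reflection in the diagonal -/

/-- Reflection of a set of squares in the diagonal. -/
def transpose (d : Finset (ℤ × ℤ)) : Finset (ℤ × ℤ) :=
  d.map (Equiv.prodComm ℤ ℤ).toEmbedding

theorem mem_transpose {d : Finset (ℤ × ℤ)} {s : ℤ × ℤ} :
    s ∈ transpose d ↔ s.swap ∈ d := by
  obtain ⟨i, j⟩ := s
  simp [transpose]

theorem transpose_transpose (d : Finset (ℤ × ℤ)) : transpose (transpose d) = d := by
  ext s
  simp [mem_transpose]

theorem transpose_injective : Function.Injective transpose :=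
  Function.LeftInverse.injective transpose_transpose

theorem IsHorizontal.transpose {d : Finset (ℤ × ℤ)} (h : IsHorizontal d) :
    IsVertical (transpose d) := by
  obtain ⟨i, j, rfl⟩ := h
  exact ⟨j, i, by simp [DominoTilings.transpose]⟩

theorem IsVertical.transpose {d : Finset (ℤ × ℤ)} (h : IsVertical d) :
    IsHorizontal (transpose d) := by
  obtain ⟨i, j, rfl⟩ := h
  exact ⟨j, i, by simp [DominoTilings.transpose]⟩

theorem transpose_rect (a b : ℕ) : transpose (rect a b) = rect b a := by
  ext ⟨i, j⟩
  rw [mem_transpose, Prod.swap_prod_mk, mem_rect, mem_rect]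
  tauto

theorem IsDominoTiling.transpose {X : Board} {D : Finset (Finset (ℤ × ℤ))}
    (hD : IsDominoTiling X D) :
    IsDominoTiling (transpose X) (D.image DominoTilings.transpose) := by
  refine ⟨fun d hd => ?_, fun s hs => ?_⟩
  · obtain ⟨d, hdD, rfl⟩ := Finset.mem_image.1 hd
    refine ⟨fun s hs => mem_transpose.2 ((hD.1 d hdD).1 (mem_transpose.1 hs)), ?_⟩
    exact (hD.1 d hdD).2.symm.imp IsVertical.transpose IsHorizontal.transpose
  · obtain ⟨d, ⟨hd, hsd⟩, -⟩ := hD.2 _ (mem_transpose.1 hs)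
    refine ⟨DominoTilings.transpose d, ⟨Finset.mem_image_of_mem _ hd, mem_transpose.2 hsd⟩, ?_⟩
    rintro e ⟨he, hse⟩
    obtain ⟨e, heD, rfl⟩ := Finset.mem_image.1 he
    rw [hD.eq_of_mem heD hd (mem_transpose.1 hse) hsd]

theorem image_transpose_image_transpose (D : Finset (Finset (ℤ × ℤ))) :
    (D.image transpose).image transpose = D := by
  rw [Finset.image_image]
  have : transpose ∘ transpose = id := funext transpose_transpose
  rw [this, Finset.image_id]

-- A tiling partitions the board. Used with f = 1 to count dominoes and with the indicator of odd
-- columns to fix the parity of h(D).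
open Classical in
theorem IsDominoTiling.sum_eq {X : Board} {D : Finset (Finset (ℤ × ℤ))}
    (hD : IsDominoTiling X D) (f : ℤ × ℤ → ℕ) : ∑ s ∈ X, f s = ∑ d ∈ D, ∑ s ∈ d, f s := by
  have hX : X = D.biUnion id := by
    ext s
    rw [Finset.mem_biUnion]
    constructor
    · intro hs
      obtain ⟨d, ⟨hd, hsd⟩, -⟩ := hD.2 s hs
      exact ⟨d, hd, hsd⟩
    · rintro ⟨d, hd, hsd⟩
      exact (hD.1 d hd).1 hsd
  rw [hX, Finset.sum_biUnion]
  · rfl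
  · intro d hd e he hne
    refine Finset.disjoint_left.2 fun s hsd hse => hne (hD.eq_of_mem hd he hsd hse)

theorem IsDominoTiling.card_eq {X : Board} {D : Finset (Finset (ℤ × ℤ))}
    (hD : IsDominoTiling X D) : X.card = 2 * D.card := by
  have h := hD.sum_eq fun _ => 1
  simp only [← Finset.card_eq_sum_ones] at h
  rw [h, Finset.sum_congr rfl fun d hd => isHorizontal_or_isVertical_card (hD.1 d hd).2]
  simp [mul_comm]

theorem numHorizontal_add_numHorizontal_transpose {X : Board} {D : Finset (Finset (ℤ × ℤ))}
    (hD : IsDominoTiling X D) :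
    numHorizontal D + numHorizontal (D.image transpose) = D.card := by
  classical
  rw [← Finset.card_filter_add_card_filter_not (s := D) (fun d => IsHorizontal d)]
  unfold numHorizontal
  have h : (D.image transpose).filter (fun d => IsHorizontal d) =
      (D.filter (fun d => ¬ IsHorizontal d)).image transpose := by
    rw [Finset.filter_image]
    congr 1
    refine Finset.filter_congr fun d hd => ⟨fun h h' => ?_, fun h => ?_⟩
    · exact not_isHorizontal_of_isVertical h'.transpose h
    · exact ((hD.1 d hd).2.resolve_left h).transpose
  rw [← Finset.card_image_of_injective (D.filter fun d => ¬ IsHorizontal d) transpose_injective,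
    ← h]

/-- Reflection in the diagonal exchanges horizontal and vertical dominoes. -/
theorem weightedTilingSum_transpose {y : ℂ} (hy : y ≠ 0) (X : Board) {k : ℕ}
    (hX : X.card = 2 * k) :
    weightedTilingSum y X = y ^ k * weightedTilingSum y⁻¹ (transpose X) := by
  rw [weightedTilingSum, weightedTilingSum, Finset.mul_sum]
  refine Finset.sum_bij' (fun D _ => D.image transpose) (fun D _ => D.image transpose)
    ?_ ?_ ?_ ?_ ?_
  · exact fun D hD => mem_dominoTilings.2 (mem_dominoTilings.1 hD).transpose
  · intro D hD
    have := (mem_dominoTilings.1 hD).transpose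
    rw [transpose_transpose] at this
    exact mem_dominoTilings.2 this
  · exact fun D _ => image_transpose_image_transpose D
  · exact fun D _ => image_transpose_image_transpose D
  · intro D hD
    have hD := mem_dominoTilings.1 hD
    have hk : k = numHorizontal D + numHorizontal (D.image transpose) := by
      rw [numHorizontal_add_numHorizontal_transpose hD]
      have := hD.card_eq
      omega
    rw [hk, pow_add, inv_pow, mul_assoc, mul_inv_cancel₀ (pow_ne_zero _ hy), mul_one]

theorem card_rect (a b : ℕ) : (rect a b).card = a * b := by
  simp [rect]

end DominoTilings

/-! ### Operators on a chain of two-state sites -/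

namespace SpinChain

open Function

/-- Complex functions on the configurations of a chain of two-state sites. -/
def Space : Type := (ℕ → Bool) → ℂ

noncomputable instance : AddCommGroup Space := inferInstanceAs (AddCommGroup ((ℕ → Bool) → ℂ))

noncomputable instance : Module ℂ Space := inferInstanceAs (Module ℂ ((ℕ → Bool) → ℂ))

instance : CoeFun Space fun _ => (ℕ → Bool) → ℂ := ⟨fun f => f⟩

@[ext]
theorem Space.ext {f g : Space} (h : ∀ σ, f σ = g σ) : f = g := funext h

@[simp]
theorem Space.zero_apply (σ : ℕ → Bool) : (0 : Space) σ = 0 := rfl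

@[simp]
theorem Space.add_apply (f g : Space) (σ : ℕ → Bool) : (f + g) σ = f σ + g σ := rfl

@[simp]
theorem Space.neg_apply (f : Space) (σ : ℕ → Bool) : (-f) σ = -f σ := rfl

@[simp]
theorem Space.smul_apply (r : ℂ) (f : Space) (σ : ℕ → Bool) : (r • f) σ = r * f σ := rfl

/-- A `2 × 2` matrix acting at the site `j`, as a linear map. -/
noncomputable def siteMap (j : ℕ) (M : Matrix Bool Bool ℂ) : Module.End ℂ Space where
  toFun f := fun σ => M (σ j) true * f (update σ j true) + M (σ j) false * f (update σ j false)
  map_add' f g := Space.ext fun σ => by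
    change M (σ j) true * (f _ + g _) + M (σ j) false * (f _ + g _) = (_ + _) + (_ + _)
    ring
  map_smul' r f := Space.ext fun σ => by
    change M (σ j) true * (r * f _) + M (σ j) false * (r * f _) = r * (_ + _)
    ring

theorem siteMap_apply (j : ℕ) (M : Matrix Bool Bool ℂ) (f : Space) (σ : ℕ → Bool) :
    siteMap j M f σ =
      M (σ j) true * f (update σ j true) + M (σ j) false * f (update σ j false) := rfl

/-- The action of the `2 × 2` matrices at the site `j`. -/
noncomputable def siteOp (j : ℕ) : Matrix Bool Bool ℂ →ₐ[ℂ] Module.End ℂ Space :=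
  AlgHom.ofLinearMap
    { toFun := siteMap j
      map_add' := fun M N => by
        refine LinearMap.ext fun f => Space.ext fun σ => ?_
        simp only [siteMap_apply, LinearMap.add_apply, Space.add_apply, Matrix.add_apply]
        ring
      map_smul' := fun r M => by
        refine LinearMap.ext fun f => Space.ext fun σ => ?_
        simp only [siteMap_apply, LinearMap.smul_apply, Space.smul_apply, Matrix.smul_apply,
          RingHom.id_apply, smul_eq_mul]
        ring }
    (by
      refine LinearMap.ext fun f => Space.ext fun σ => ?_
      have e := update_eq_self j σ
      cases h : σ j <;> rw [h] at e <;> simp [siteMap_apply, Matrix.one_apply, h, e])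
    (fun M N => by
      refine LinearMap.ext fun f => Space.ext fun σ => ?_
      simp [siteMap_apply, Matrix.mul_apply]
      ring)

theorem siteOp_apply (j : ℕ) (M : Matrix Bool Bool ℂ) (f : Space) (σ : ℕ → Bool) :
    siteOp j M f σ =
      M (σ j) true * f (update σ j true) + M (σ j) false * f (update σ j false) := rfl

theorem commute_siteOp {j k : ℕ} (h : j ≠ k) (M N : Matrix Bool Bool ℂ) :
    Commute (siteOp j M) (siteOp k N) := by
  refine LinearMap.ext fun f => Space.ext fun σ => ?_
  simp only [Module.End.mul_apply, siteOp_apply, update_of_ne h, update_of_ne h.symm,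
    update_comm h]
  ring

/-- Flip. -/
def flipM : Matrix Bool Bool ℂ := fun a b => if a = b then 0 else 1
/-- Fill an empty site. -/
def lowerM : Matrix Bool Bool ℂ := fun a b => if a = false ∧ b = true then 1 else 0
/-- Empty a filled site. -/
def raiseM : Matrix Bool Bool ℂ := fun a b => if a = true ∧ b = false then 1 else 0
/-- Sign of the occupation. -/
def signM : Matrix Bool Bool ℂ := fun a b => if a = b then (if a then -1 else 1) else 0

noncomputable def flip (j : ℕ) : Module.End ℂ Space := siteOp j flipM
noncomputable def lower (j : ℕ) : Module.End ℂ Space := siteOp j lowerM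
noncomputable def raise (j : ℕ) : Module.End ℂ Space := siteOp j raiseM
noncomputable def sign (j : ℕ) : Module.End ℂ Space := siteOp j signM

theorem flip_apply (j : ℕ) (f : Space) (σ : ℕ → Bool) :
    flip j f σ = f (update σ j (!σ j)) := by
  cases h : σ j <;> simp [flip, siteOp_apply, flipM, h]

theorem lower_apply (j : ℕ) (f : Space) (σ : ℕ → Bool) :
    lower j f σ = if σ j then 0 else f (update σ j true) := by
  cases h : σ j <;> simp [lower, siteOp_apply, lowerM, h]

theorem raise_apply (j : ℕ) (f : Space) (σ : ℕ → Bool) :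
    raise j f σ = if σ j then f (update σ j false) else 0 := by
  cases h : σ j <;> simp [raise, siteOp_apply, raiseM, h]

theorem sign_apply (j : ℕ) (f : Space) (σ : ℕ → Bool) :
    sign j f σ = if σ j then -f σ else f σ := by
  have e := update_eq_self j σ
  cases h : σ j <;> rw [h] at e <;> simp [sign, siteOp_apply, signM, h, e]

/-- One step of the transfer operator. -/
noncomputable def step (y : ℂ) (j : ℕ) : Module.End ℂ Space :=
  (1 + y • (lower j * lower (j + 1))) * flip j

/-- One square is processed. A filled site is a square already covered and is cleared; an empty one
sends a vertical domino into the row below, filling site `j`, or takes a horizontal domino, which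
needs site `j + 1` empty and fills it. -/
theorem step_apply (y : ℂ) (j : ℕ) (f : Space) (σ : ℕ → Bool) :
    step y j f σ = f (update σ j (!σ j)) +
      if σ j = false ∧ σ (j + 1) = false then y * f (update σ (j + 1) true) else 0 := by
  have e := update_eq_self j σ
  cases h : σ j <;> cases h' : σ (j + 1) <;> rw [h] at e <;>
    simp [step, flip_apply, lower_apply, h, h', update_comm (show j + 1 ≠ j by omega), e]

/-- This and the next relations are checked on the four occupations of `j` and `j + 1`. The factors
`sign j` that appear are the reason for passing to fermions. -/
theorem lower_mul_step (y : ℂ) (j : ℕ) : lower j * step y j = step y j * raise j := by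
  refine LinearMap.ext fun f => Space.ext fun σ => ?_
  cases h : σ j <;> cases h' : σ (j + 1) <;>
    simp [step_apply, lower_apply, raise_apply, h, h']

theorem sign_lower_mul_step (y : ℂ) (j : ℕ) :
    sign j * lower (j + 1) * step y j = -(step y j * (sign j * lower (j + 1))) := by
  refine LinearMap.ext fun f => Space.ext fun σ => ?_
  cases h : σ j <;> cases h' : σ (j + 1) <;>
    simp [step_apply, lower_apply, sign_apply, h, h', update_comm (show j + 1 ≠ j by omega)]

/-- Each term of a step changes the number of filled sites among `j`, `j + 1` by an odd amount. -/
theorem sign_sign_mul_step (y : ℂ) (j : ℕ) :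
    sign j * sign (j + 1) * step y j = -(step y j * (sign j * sign (j + 1))) := by
  refine LinearMap.ext fun f => Space.ext fun σ => ?_
  cases h : σ j <;> cases h' : σ (j + 1) <;> simp [step_apply, sign_apply, h, h']
  ring

theorem raise_mul_step (y : ℂ) (j : ℕ) :
    raise j * step y j = step y j * (lower j + y • (sign j * lower (j + 1))) := by
  refine LinearMap.ext fun f => Space.ext fun σ => ?_
  cases h : σ j <;> cases h' : σ (j + 1) <;>
    simp [step_apply, lower_apply, raise_apply, sign_apply, h, h',
      update_comm (show j + 1 ≠ j by omega)]

theorem sign_raise_mul_step (y : ℂ) (j : ℕ) :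
    sign j * raise (j + 1) * step y j =
      step y j * (-(sign j * raise (j + 1)) + y • raise j) := by
  refine LinearMap.ext fun f => Space.ext fun σ => ?_
  have e := update_eq_self j σ
  have e' := update_eq_self (j + 1) σ
  cases h : σ j <;> cases h' : σ (j + 1) <;> rw [h] at e <;> rw [h'] at e' <;>
    simp [step_apply, raise_apply, sign_apply, h, h', e, e',
      update_comm (show j + 1 ≠ j by omega)]

theorem flip_mul_flip (j : ℕ) : flip j * flip j = 1 := by
  refine LinearMap.ext fun f => Space.ext fun σ => ?_
  simp [flip_apply]

theorem flip_mul_lower (j : ℕ) : flip j * lower j = raise j * flip j := by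
  refine LinearMap.ext fun f => Space.ext fun σ => ?_
  cases h : σ j <;> simp [flip_apply, lower_apply, raise_apply, h]

theorem lower_mul_lower (j : ℕ) : lower j * lower j = 0 := by
  refine LinearMap.ext fun f => Space.ext fun σ => ?_
  simp [lower_apply]

theorem sign_mul_sign (j : ℕ) : sign j * sign j = 1 := by
  refine LinearMap.ext fun f => Space.ext fun σ => ?_
  cases h : σ j <;> simp [sign_apply, h]

theorem siteOp_commute_step {j k : ℕ} (h : k ≠ j) (h' : k ≠ j + 1) (y : ℂ)
    (M : Matrix Bool Bool ℂ) : Commute (siteOp k M) (step y j) :=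
  ((Commute.one_right _).add_right
    (((commute_siteOp h _ _).mul_right (commute_siteOp h' _ _)).smul_right y)).mul_right
    (commute_siteOp h _ _)

/-! ### Jordan–Wigner fermions -/

/-- The product of the signs of the sites below `k`. -/
noncomputable def stringSign : ℕ → Module.End ℂ Space
  | 0 => 1
  | k + 1 => stringSign k * sign k

theorem stringSign_commute_siteOp {j k : ℕ} (h : k ≤ j) (M : Matrix Bool Bool ℂ) :
    Commute (stringSign k) (siteOp j M) := by
  induction k with
  | zero => exact Commute.one_left _
  | succ k ih => exact (ih (by omega)).mul_left (commute_siteOp (by omega) _ _)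

theorem stringSign_mul_stringSign (k : ℕ) : stringSign k * stringSign k = 1 := by
  induction k with
  | zero => simp [stringSign]
  | succ k ih =>
    have h : Commute (stringSign k) (sign k) := stringSign_commute_siteOp le_rfl _
    rw [stringSign, mul_assoc, ← mul_assoc (sign k), ← h.eq, mul_assoc, sign_mul_sign, mul_one, ih]

theorem stringSign_commute_step {j k : ℕ} (h : k ≤ j) (y : ℂ) :
    Commute (stringSign k) (step y j) := by
  induction k with
  | zero => exact Commute.one_left _
  | succ k ih =>
    exact (ih (by omega)).mul_left (siteOp_commute_step (by omega) (by omega) _ _)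

theorem stringSign_mul_step (y : ℂ) (j i : ℕ) :
    stringSign (j + 2 + i) * step y j = -(step y j * stringSign (j + 2 + i)) := by
  induction i with
  | zero =>
    have h := (stringSign_commute_step (le_refl j) y).eq
    calc stringSign (j + 2) * step y j
        = stringSign j * (sign j * sign (j + 1) * step y j) := by
          simp only [stringSign, mul_assoc]
      _ = -(step y j * stringSign (j + 2)) := by
          rw [sign_sign_mul_step, mul_neg, ← mul_assoc, h]
          simp only [stringSign, mul_assoc]
  | succ i ih =>
    have h : Commute (sign (j + 2 + i)) (step y j) :=
      siteOp_commute_step (by omega) (by omega) _ _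
    rw [← add_assoc, stringSign, mul_assoc, h.eq, ← mul_assoc, ih, neg_mul, mul_assoc]

/-- The annihilation operator of the Jordan-Wigner fermion at `k`. -/
noncomputable def ann (k : ℕ) : Module.End ℂ Space := stringSign k * lower k

/-- The creation operator of the Jordan-Wigner fermion at `k`. -/
noncomputable def cre (k : ℕ) : Module.End ℂ Space := stringSign k * raise k

theorem stringSign_siteOp_mul_step (y : ℂ) (j i : ℕ) (M : Matrix Bool Bool ℂ) :
    stringSign (j + 2 + i) * siteOp (j + 2 + i) M * step y j =
      -(step y j * (stringSign (j + 2 + i) * siteOp (j + 2 + i) M)) := by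
  rw [mul_assoc, (siteOp_commute_step (by omega) (by omega) y M).eq, ← mul_assoc,
    stringSign_mul_step, neg_mul, mul_assoc]

theorem ann_mul_step_self (y : ℂ) (j : ℕ) : ann j * step y j = step y j * cre j := by
  rw [ann, cre, mul_assoc, lower_mul_step, ← mul_assoc,
    (stringSign_commute_step le_rfl y).eq, mul_assoc]

theorem ann_succ (j : ℕ) : ann (j + 1) = stringSign j * (sign j * lower (j + 1)) := by
  rw [ann, stringSign, mul_assoc]

theorem cre_succ (j : ℕ) : cre (j + 1) = stringSign j * (sign j * raise (j + 1)) := by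
  rw [cre, stringSign, mul_assoc]

theorem ann_mul_step_of_lt (y : ℂ) (j i : ℕ) :
    ann (j + 1 + i) * step y j = -(step y j * ann (j + 1 + i)) := by
  cases i with
  | zero =>
    rw [add_zero, ann_succ, mul_assoc, sign_lower_mul_step, mul_neg, ← mul_assoc,
      (stringSign_commute_step le_rfl y).eq, mul_assoc]
  | succ i =>
    have := stringSign_siteOp_mul_step y j i lowerM
    rwa [show j + 1 + (i + 1) = j + 2 + i by omega]

theorem cre_mul_step_self (y : ℂ) (j : ℕ) :
    cre j * step y j = step y j * (ann j + y • ann (j + 1)) := by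
  rw [cre, mul_assoc, raise_mul_step, ← mul_assoc, (stringSign_commute_step le_rfl y).eq,
    mul_assoc, mul_add, mul_smul_comm, ← ann_succ, ← ann]

theorem cre_succ_mul_step (y : ℂ) (j : ℕ) :
    cre (j + 1) * step y j = step y j * (-cre (j + 1) + y • cre j) := by
  rw [cre_succ, mul_assoc, sign_raise_mul_step, ← mul_assoc,
    (stringSign_commute_step le_rfl y).eq, mul_assoc, mul_add, mul_smul_comm, mul_neg, ← cre]

theorem cre_mul_step_of_lt (y : ℂ) (j i : ℕ) :
    cre (j + 2 + i) * step y j = -(step y j * cre (j + 2 + i)) :=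
  stringSign_siteOp_mul_step y j i raiseM

/-! ### The transfer operator acts linearly on fermions -/

/-- The transfer operator of the segment of length `d` that starts at `j`. -/
noncomputable def transfer (y : ℂ) : ℕ → ℕ → Module.End ℂ Space
  | 0, _ => 1
  -- The last square of a row has no right neighbour, so weight 0 excludes a horizontal domino
  -- there.
  | d + 1, j => step (if d = 0 then 0 else y) j * transfer y d (j + 1)

theorem siteOp_commute_transfer {j k d : ℕ} (h : k < j ∨ j + d ≤ k) (y : ℂ)
    (M : Matrix Bool Bool ℂ) : Commute (siteOp k M) (transfer y d j) := by
  induction d generalizing j with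
  | zero => exact Commute.one_right _
  | succ d ih =>
    refine Commute.mul_right ?_ (ih (by omega))
    rcases Nat.eq_zero_or_pos d with rfl | hd
    · rw [if_pos rfl, step, zero_smul, add_zero, one_mul]
      exact commute_siteOp (by omega) _ _
    · exact siteOp_commute_step (by omega) (by omega) _ _

theorem stringSign_commute_transfer {j k : ℕ} (h : k ≤ j) (y : ℂ) (d : ℕ) :
    Commute (stringSign k) (transfer y d j) := by
  induction k with
  | zero => exact Commute.one_left _
  | succ k ih => exact (ih (by omega)).mul_left (siteOp_commute_transfer (by omega) _ _)

theorem ann_commute_transfer (y : ℂ) (d j : ℕ) : Commute (ann j) (transfer y d (j + 1)) :=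
  (stringSign_commute_transfer (by omega) y d).mul_left (siteOp_commute_transfer (by omega) _ _)

theorem cre_commute_transfer (y : ℂ) (d j : ℕ) : Commute (cre j) (transfer y d (j + 1)) :=
  (stringSign_commute_transfer (by omega) y d).mul_left (siteOp_commute_transfer (by omega) _ _)

/-- Each of the `i` steps to the left contributes -1, the step at the site itself turns `ann` into
`cre`, and the later steps commute with it. -/
theorem ann_mul_transfer (y : ℂ) {d i : ℕ} (h : i < d) (j : ℕ) :
    ann (j + i) * transfer y d j = (-1 : ℂ) ^ i • (transfer y d j * cre (j + i)) := by
  induction d generalizing i j with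
  | zero => omega
  | succ d ih =>
    rw [transfer, ← mul_assoc]
    cases i with
    | zero =>
      rw [add_zero, ann_mul_step_self, mul_assoc, (cre_commute_transfer y d j).eq]
      simp [mul_assoc]
    | succ i =>
      have := ih (i := i) (by omega) (j + 1)
      rw [show j + (i + 1) = j + 1 + i by omega, ann_mul_step_of_lt, neg_mul, mul_assoc, this,
        pow_succ]
      simp [mul_assoc]

theorem cre_mul_transfer_self (y : ℂ) (d j : ℕ) :
    cre j * transfer y (d + 1) j =
      transfer y (d + 1) j * (ann j + if d = 0 then 0 else y • cre (j + 1)) := by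
  rw [transfer, ← mul_assoc, cre_mul_step_self, mul_assoc, mul_assoc, add_mul,
    (ann_commute_transfer y d j).eq, mul_add]
  rcases Nat.eq_zero_or_pos d with rfl | hd
  · simp
  · have := ann_mul_transfer y hd (j + 1)
    simp only [hd.ne', if_false, smul_mul_assoc, mul_smul_comm]
    rw [add_zero, pow_zero, one_smul] at this
    simp only [mul_add, this, mul_smul_comm]

/-- The left neighbour enters at the step of site `j + i`; the right one enters at the site's own
step, as an `ann` that the rest of the row turns into `cre`. -/
theorem cre_mul_transfer (y : ℂ) {d i : ℕ} (h : i + 1 < d) (j : ℕ) :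
    cre (j + i + 1) * transfer y d j =
      (-1 : ℂ) ^ (i + 1) • (transfer y d j *
        (ann (j + i + 1) + (if i + 2 = d then 0 else y • cre (j + i + 2)) - y • cre (j + i))) := by
  induction d generalizing i j with
  | zero => omega
  | succ d ih =>
    rw [transfer, ← mul_assoc, if_neg (by omega)]
    cases i with
    | zero =>
      obtain ⟨d, rfl⟩ : ∃ e, d = e + 1 := ⟨d - 1, by omega⟩
      rw [add_zero, cre_succ_mul_step, mul_assoc, add_mul, neg_mul, cre_mul_transfer_self,
        smul_mul_assoc, (cre_commute_transfer y _ j).eq]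
      simp only [zero_add, pow_one, mul_assoc, mul_add, mul_sub, mul_smul_comm, neg_one_smul]
      rcases Nat.eq_zero_or_pos d with rfl | hd
      · simp [add_comm, sub_eq_add_neg]
      · rw [if_neg (by omega), if_neg (by omega)]
        simp only [mul_add, mul_neg, neg_add, mul_smul_comm]
        module
    | succ i =>
      have := ih (i := i) (by omega) (j + 1)
      rw [show j + 1 + i + 1 = j + 2 + i by omega, show j + 1 + i + 2 = j + (i + 1) + 2 by omega,
        show j + 1 + i = j + (i + 1) by omega] at this
      rw [show j + (i + 1) + 1 = j + 2 + i by omega, cre_mul_step_of_lt, neg_mul, mul_assoc, this,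
        pow_succ _ (i + 1)]
      simp [mul_assoc]

end SpinChain

/-! ### Inverting the transfer operator -/

namespace SpinChain

open Function

/-- The flip of all sites of the segment of length `d` that starts at `j`. -/
noncomputable def flipAll : ℕ → ℕ → Module.End ℂ Space
  | 0, _ => 1
  | d + 1, j => flip j * flipAll d (j + 1)

theorem siteOp_commute_flipAll {j k d : ℕ} (h : k < j) (M : Matrix Bool Bool ℂ) :
    Commute (siteOp k M) (flipAll d j) := by
  induction d generalizing j with
  | zero => exact Commute.one_right _
  | succ d ih => exact (commute_siteOp (by omega) _ _).mul_right (ih (by omega))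

theorem flipAll_mul_flipAll (d j : ℕ) : flipAll d j * flipAll d j = 1 := by
  induction d generalizing j with
  | zero => exact mul_one _
  | succ d ih =>
    have h : Commute (flip j) (flipAll d (j + 1)) := siteOp_commute_flipAll (by omega) _
    rw [flipAll, h.symm.mul_mul_mul_comm, flip_mul_flip, ih, one_mul]

theorem pair_mul_pair (j : ℕ) : lower j * lower (j + 1) * (lower j * lower (j + 1)) = 0 := by
  have h : Commute (lower j) (lower (j + 1)) := commute_siteOp (by omega) _ _
  rw [h.symm.mul_mul_mul_comm, lower_mul_lower, zero_mul]

theorem step_zero (j : ℕ) : step 0 j = flip j := by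
  rw [step, zero_smul, add_zero, one_mul]

theorem lower_mul_transfer (y : ℂ) (d j : ℕ) :
    lower j * transfer y (d + 1) j = transfer y (d + 1) j * raise j := by
  have h : Commute (raise j) (transfer y d (j + 1)) := siteOp_commute_transfer (by omega) _ _
  rw [transfer, ← mul_assoc, lower_mul_step, mul_assoc, h.eq, mul_assoc]

/-- The inverse of the transfer operator is thus its conjugate by the total flip with `y` negated.
Peel off the first site: the pair P = `lower j * lower (j + 1)` commutes with T X for the remaining
segment, since X turns `lower (j + 1)` into `raise (j + 1)` and T turns it back. Then (1 + yP)(1 -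
yP) = 1 because P² = 0. -/
theorem transfer_mul_flipAll_mul_transfer (y : ℂ) (d j : ℕ) :
    transfer y d j * flipAll d j * transfer (-y) d j = flipAll d j := by
  induction d generalizing j with
  | zero => simp [transfer, flipAll]
  | succ d ih =>
    have hT : ∀ M z, Commute (siteOp j M) (transfer z d (j + 1)) := fun M z =>
      siteOp_commute_transfer (by omega) _ _
    have hX : ∀ M, Commute (siteOp j M) (flipAll d (j + 1)) := fun M =>
      siteOp_commute_flipAll (by omega) _
    rcases Nat.eq_zero_or_pos d with rfl | hd
    · simp [transfer, flipAll, step_zero, flip_mul_flip]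
    obtain ⟨e, rfl⟩ : ∃ e, d = e + 1 := ⟨d - 1, by omega⟩
    set T := transfer y (e + 1) (j + 1) with hTdef
    set T' := transfer (-y) (e + 1) (j + 1) with hTdef'
    set X := flipAll (e + 1) (j + 1) with hXdef
    have hXl : X * lower (j + 1) = raise (j + 1) * X := by
      have h : Commute (lower (j + 1)) (flipAll e (j + 2)) := siteOp_commute_flipAll (by omega) _
      rw [hXdef, flipAll, mul_assoc, ← h.eq, ← mul_assoc, flip_mul_lower, mul_assoc]
    have hTr : T * raise (j + 1) = lower (j + 1) * T := (lower_mul_transfer y e (j + 1)).symm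
    have hT0 : transfer y (e + 1 + 1) j = step y j * T := by simp [transfer, hTdef]
    have hT0' : transfer (-y) (e + 1 + 1) j = step (-y) j * T' := by simp [transfer, hTdef']
    have hX0 : flipAll (e + 1 + 1) j = flip j * X := rfl
    have hlT : lower j * T = T * lower j := (hT _ _).eq
    have hlX : lower j * X = X * lower j := (hX _).eq
    have hfT : flip j * T = T * flip j := (hT _ _).eq
    have hfT' : flip j * T' = T' * flip j := (hT _ _).eq
    have hfX : flip j * X = X * flip j := (hX _).eq
    have hpair : T * X * (lower j * lower (j + 1)) = lower j * lower (j + 1) * (T * X) := by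
      have h : lower j * lower (j + 1) = lower (j + 1) * lower j :=
        (commute_siteOp (by omega) _ _).eq
      calc T * X * (lower j * lower (j + 1)) = T * (X * lower (j + 1)) * lower j := by
            rw [h]; simp only [mul_assoc]
        _ = lower (j + 1) * T * (X * lower j) := by
            rw [hXl, ← mul_assoc T, hTr]; simp only [mul_assoc]
        _ = lower (j + 1) * (lower j * T) * X := by
            rw [← hlX, hlT]; simp only [mul_assoc]
        _ = _ := by rw [h]; simp only [mul_assoc]
    have hprod : (1 + y • (lower j * lower (j + 1))) * (1 + (-y) • (lower j * lower (j + 1))) =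
        1 := by
      have := pair_mul_pair j
      simp only [mul_add, add_mul, mul_one, one_mul, smul_mul_assoc, mul_smul_comm, this]
      module
    calc transfer y (e + 1 + 1) j * flipAll (e + 1 + 1) j * transfer (-y) (e + 1 + 1) j
        = (1 + y • (lower j * lower (j + 1))) * (flip j * T) * (flip j * X) *
          (1 + (-y) • (lower j * lower (j + 1))) * (flip j * T') := by
          rw [hT0, hT0', hX0, step, step]; simp only [mul_assoc]
      _ = (1 + y • (lower j * lower (j + 1))) * T * (flip j * flip j) * X *
          (1 + (-y) • (lower j * lower (j + 1))) * (T' * flip j) := by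
          rw [hfT, hfT']; simp only [mul_assoc]
      _ = (1 + y • (lower j * lower (j + 1))) *
          (T * X * (1 + (-y) • (lower j * lower (j + 1)))) * (T' * flip j) := by
          rw [flip_mul_flip, mul_one]; simp only [mul_assoc]
      _ = (1 + y • (lower j * lower (j + 1))) * (1 + (-y) • (lower j * lower (j + 1))) *
          (T * X * T') * flip j := by
          rw [mul_add (T * X), mul_smul_comm, hpair, ← smul_mul_assoc, mul_one]
          simp only [add_mul, mul_add, one_mul, mul_one, mul_assoc, smul_mul_assoc]
      _ = flipAll (e + 1 + 1) j := by
          rw [hprod, one_mul, ih, hX0, hfX]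

theorem isUnit_transfer (y : ℂ) (d j : ℕ) : IsUnit (transfer y d j) := by
  have h1 := transfer_mul_flipAll_mul_transfer y d j
  have h2 := transfer_mul_flipAll_mul_transfer (-y) d j
  rw [neg_neg] at h2
  have hX := flipAll_mul_flipAll d j
  refine isUnit_iff_exists.2 ⟨flipAll d j * transfer (-y) d j * flipAll d j, ?_, ?_⟩
  · rw [← mul_assoc, ← mul_assoc, h1, hX]
  · rw [mul_assoc, mul_assoc, ← mul_assoc (transfer (-y) d j), h2, hX]

/-! ### The wave equation and the return of the vacuum -/

/-- A solution of the discrete wave equation with Dirichlet boundary conditions is antiperiodic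
up to reflection. -/
theorem wave_reflection {M : Type*} [AddCommGroup M] {n : ℕ} (hn : 0 < n) (f : ℕ → ℤ → M)
    (h0 : ∀ t, f 0 t = 0) (hfn : ∀ t, f n t = 0)
    (hf : ∀ j t, j + 1 < n → f (j + 1) (t + 1) + f (j + 1) (t - 1) = f (j + 2) t + f j t)
    {j : ℕ} (hj : j ≤ n) (t : ℤ) : f (n - j) (t + n) = -f j t := by
  -- By the wave equation the left side is constant along diagonals; its value is read off at the
  -- wall j = 0.
  have step : ∀ j t, j < n → f j (t + 1) - f (j + 1) t = -f 1 (t - j) := by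
    intro j
    induction j with
    | zero => intro t _; simp [h0]
    | succ j ih =>
      intro t hj
      have h1 := hf j t hj
      have h2 := ih (t - 1) (by omega)
      rw [sub_add_cancel] at h2
      have h3 : (t - ((j + 1 : ℕ) : ℤ)) = t - 1 - j := by push_cast; ring
      rw [h3, ← h2, sub_eq_sub_iff_add_eq_add, h1, add_comm]
  -- Two consecutive columns determine the next, so the induction carries a pair. Column 0 is the
  -- two walls, column 1 is `step` at the wall `n`.
  have main : ∀ j, (j ≤ n → ∀ t, f (n - j) (t + n) = -f j t) ∧
      (j + 1 ≤ n → ∀ t, f (n - (j + 1)) (t + n) = -f (j + 1) t) := by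
    intro j
    induction j with
    | zero =>
      refine ⟨fun _ t => by simp [h0, hfn], fun h t => ?_⟩
      have h1 := step (n - 1) (t + n - 1) (by omega)
      rw [sub_add_cancel, show n - 1 + 1 = n by omega, hfn, sub_zero] at h1
      rw [zero_add, h1]
      congr 2
      push_cast [hn]
      ring
    | succ j ih =>
      refine ⟨ih.2, fun h t => ?_⟩
      have h1 := hf j t (by omega)
      have h2 := hf (n - (j + 2)) (t + n) (by omega)
      have e1 : n - (j + 2) + 1 = n - (j + 1) := by omega
      have e2 : n - (j + 2) + 2 = n - j := by omega
      rw [e1, e2, show t + n + 1 = (t + 1) + n by ring, show t + n - 1 = (t - 1) + n by ring,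
        ih.2 (by omega), ih.2 (by omega), ih.1 (by omega), ← neg_add, h1, neg_add_rev] at h2
      exact (add_left_cancel h2).symm
  exact (main j).1 hj t

/-- The annihilation operators of the segment `1, …, b`, and zero outside of it. -/
noncomputable def annOn (b k : ℕ) : Module.End ℂ Space :=
  if k = 0 ∨ b < k then 0 else ann k

/-- Moving `ann` past one T gives ± `cre`, and past a second T the three-term rule. Rewriting the
neighbouring T `cre` as ± `ann` T eliminates the creation operators and leaves a recurrence of
second order in time. -/
theorem ann_mul_transfer_sq (y : ℂ) {b i : ℕ} (hi : i < b) :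
    annOn b (i + 1) * transfer y b 1 * transfer y b 1 =
      transfer y b 1 * transfer y b 1 * annOn b (i + 1) +
        ((-1) ^ (i + 1) * y) •
          (transfer y b 1 * (annOn b (i + 2) - annOn b i) * transfer y b 1) := by
  have hsq : ∀ m : ℕ, (-1 : ℂ) ^ m * (-1) ^ m = 1 := fun m => by
    rw [← mul_pow]; simp
  have hann : ∀ k, k < b → annOn b (k + 1) = ann (k + 1) := fun k hk => by
    rw [annOn, if_neg (by omega)]
  have hT : ∀ k, k < b → ann (k + 1) * transfer y b 1 =
      (-1 : ℂ) ^ k • (transfer y b 1 * cre (k + 1)) := fun k hk => by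
    have := ann_mul_transfer y hk 1
    rwa [add_comm 1 k] at this
  have hT' : ∀ k, k < b → transfer y b 1 * cre (k + 1) =
      (-1 : ℂ) ^ k • (ann (k + 1) * transfer y b 1) := fun k hk => by
    rw [hT k hk, smul_smul, hsq, one_smul]
  have hup : transfer y b 1 * (if i + 1 = b then 0 else y • cre (i + 2)) =
      ((-1) ^ (i + 1) * y) • (annOn b (i + 2) * transfer y b 1) := by
    split_ifs with h
    · rw [annOn, if_pos (by omega)]
      simp
    · rw [hann _ (by omega), mul_smul_comm, hT' _ (by omega), smul_smul, mul_comm]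
  set T := transfer y b 1 with hTdef
  have hcre : cre (i + 1) * T = (-1 : ℂ) ^ i • (T * ann (i + 1) +
      ((-1) ^ (i + 1) * y) • ((annOn b (i + 2) - annOn b i) * T)) := by
    cases i with
    | zero =>
      obtain ⟨d, rfl⟩ : ∃ d, b = d + 1 := ⟨b - 1, by omega⟩
      have h := cre_mul_transfer_self y d 1
      have h0 : annOn (d + 1) 0 = 0 := by rw [annOn, if_pos (by omega)]
      rw [h0, sub_zero, ← hup, pow_zero, one_smul, ← mul_add]
      simp only [zero_add]
      rw [hTdef, h]
      congr 3
      simp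
    | succ i =>
      have h := cre_mul_transfer y hi 1
      rw [show 1 + i + 1 = i + 1 + 1 by ring, show 1 + i + 2 = i + 1 + 2 by ring,
        show 1 + i = i + 1 by ring, mul_sub, mul_add, hup, mul_smul_comm, hT' _ (by omega),
        ← hann i (by omega), ← hTdef] at h
      rw [h, sub_mul, pow_succ, pow_succ]
      congr 1
      module
  rw [hann _ hi, hT _ hi, smul_mul_assoc, mul_assoc, hcre, mul_smul_comm, smul_smul, hsq,
    one_smul, mul_add, mul_smul_comm]
  simp only [mul_assoc]

/-- The indicator function of the empty configuration. -/
noncomputable def vacuum : Space := open Classical in fun σ => if σ = fun _ => false then 1 else 0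

theorem lower_vacuum (j : ℕ) : lower j vacuum = 0 := by
  refine Space.ext fun σ => ?_
  rw [lower_apply, Space.zero_apply]
  split_ifs
  · rfl
  · refine if_neg fun h => ?_
    have := congrFun h j
    simp at this

theorem eq_smul_vacuum {f : Space} (h : ∀ j, lower j f = 0) :
    f = f (fun _ => false) • vacuum := by
  refine Space.ext fun σ => ?_
  rw [Space.smul_apply]
  by_cases hσ : σ = fun _ => false
  · simp [vacuum, hσ]
  · obtain ⟨j, hj⟩ : ∃ j, σ j = true := by
      by_contra! hc
      exact hσ (funext fun j => by simpa using hc j)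
    have h1 := congrArg (fun g : Space => g (update σ j false)) (h j)
    have e := update_eq_self j σ
    rw [hj] at e
    simp only [lower_apply, update_self, update_idem, e, Space.zero_apply] at h1
    rw [if_neg (by simp)] at h1
    simp [vacuum, hσ, h1]

/-- A solution of the wave equation made of conjugates of the annihilation operators. -/
noncomputable def annWave (y : ℂ) (b : ℕ) (u : (Module.End ℂ Space)ˣ) (j : ℕ) (t : ℤ) :
    Module.End ℂ Space :=
  (y ^ (-t) * ∏ i ∈ Finset.range j, (-1) ^ i) •
    (((u ^ (-t) : (Module.End ℂ Space)ˣ) : Module.End ℂ Space) * annOn b j *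
      ((u ^ t : (Module.End ℂ Space)ˣ) : Module.End ℂ Space))

/-- The recurrence has a difference in time and in space. As y⁻¹ = -y, the factor y^(-t) makes the
time difference a sum; the product of signs absorbs (-1)^(j+1) and does the same in space. -/
theorem annWave_wave {y : ℂ} (hy : y * y = -1) {b : ℕ} {u : (Module.End ℂ Space)ˣ}
    (hu : (u : Module.End ℂ Space) = transfer y b 1) {j : ℕ} (hj : j < b) (t : ℤ) :
    annWave y b u (j + 1) (t + 1) + annWave y b u (j + 1) (t - 1) =
      annWave y b u (j + 2) t + annWave y b u j t := by
  have hy0 : y ≠ 0 := by rintro rfl; norm_num at hy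
  have hrel := ann_mul_transfer_sq y hj
  rw [← hu] at hrel
  have e1 : u ^ (t + 1) = u * u * u ^ (t - 1) := by
    rw [mul_assoc, ← zpow_one_add, ← zpow_one_add]; congr 1; ring
  have e2 : u ^ t = u * u ^ (t - 1) := by rw [← zpow_one_add]; congr 1; ring
  have e3 : u ^ (-(t - 1)) = u ^ (-(t + 1)) * u * u := by
    rw [← zpow_add_one, ← zpow_add_one]; congr 1; ring
  have e4 : u ^ (-t) = u ^ (-(t + 1)) * u := by rw [← zpow_add_one]; congr 1; ring
  have y1 : y ^ (-(t + 1)) = -(y ^ (-t) * y) := by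
    rw [show -t = -(t + 1) + 1 by ring, zpow_add_one₀ hy0, mul_assoc, hy]; ring
  have y2 : y ^ (-(t - 1)) = y ^ (-t) * y := by
    rw [show -(t - 1) = -t + 1 by ring, zpow_add_one₀ hy0]
  have hsq : (-1 : ℂ) ^ j * (-1) ^ j = 1 := by rw [← mul_pow]; simp
  unfold annWave
  rw [y1, y2, e1, e2, e3, e4]
  simp only [Units.val_mul, Finset.prod_range_succ]
  generalize ((u ^ (-(t + 1)) : (Module.End ℂ Space)ˣ) : Module.End ℂ Space) = P
  generalize ((u ^ (t - 1) : (Module.End ℂ Space)ˣ) : Module.End ℂ Space) = Q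
  generalize (∏ i ∈ Finset.range j, (-1 : ℂ) ^ i) = s
  generalize (u : Module.End ℂ Space) = U at *
  have h1 : P * annOn b (j + 1) * (U * U * Q) = P * (annOn b (j + 1) * U * U) * Q := by
    simp only [mul_assoc]
  rw [h1, hrel]
  simp only [mul_add, add_mul, mul_sub, sub_mul, smul_mul_assoc, mul_smul_comm, mul_assoc]
  match_scalars
  · ring
  · linear_combination y ^ (-t) * s * ((-1) ^ j * (-1) ^ j) * hy
  · linear_combination -(y ^ (-t) * y ^ 2 * s) * hsq - y ^ (-t) * s * hy

theorem transfer_pow_vacuum {y : ℂ} (hy : y * y = -1) (b : ℕ) :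
    (transfer y b 1 ^ (b + 1)) vacuum =
      ((transfer y b 1 ^ (b + 1)) vacuum (fun _ => false)) • vacuum := by
  have hy0 : y ≠ 0 := by rintro rfl; norm_num at hy
  refine eq_smul_vacuum fun k => ?_
  by_cases hk : k = 0 ∨ b < k
  · have h : Commute (lower k) (transfer y b 1) := siteOp_commute_transfer (by omega) _ _
    rw [← Module.End.mul_apply, (h.pow_right _).eq, Module.End.mul_apply, lower_vacuum, map_zero]
  push Not at hk
  obtain ⟨u, hu⟩ := isUnit_transfer y b 1
  -- Reflection from time 0 to time b + 1: the conjugate of `ann k` by T^(b+1) is a multiple of `ann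
  -- (b + 1 - k)`, hence kills the vacuum.
  have h := wave_reflection (n := b + 1) (by omega) (annWave y b u)
    (fun t => by simp [annWave, annOn]) (fun t => by simp [annWave, annOn])
    (fun j t hj => annWave_wave hy hu (by omega) t) (j := b + 1 - k) (by omega) 0
  rw [show b + 1 - (b + 1 - k) = k by omega, zero_add] at h
  have hv : annWave y b u (b + 1 - k) 0 vacuum = 0 := by
    rw [annWave, annOn, if_neg (by omega)]
    simp [ann, lower_vacuum]
  have h1 := congrArg (fun A : Module.End ℂ Space => A vacuum) h
  simp only [LinearMap.neg_apply, hv, neg_zero] at h1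
  rw [annWave, LinearMap.smul_apply, smul_eq_zero_iff_right, annOn, if_neg (by omega), ann] at h1
  · have h2 := congrArg (fun f => stringSign k
      (((u ^ ((b + 1 : ℕ) : ℤ) : (Module.End ℂ Space)ˣ) : Module.End ℂ Space) f)) h1
    simp only [map_zero, ← Module.End.mul_apply] at h2
    rw [← hu]
    have h3 : stringSign k * (((u ^ ((b + 1 : ℕ) : ℤ) : (Module.End ℂ Space)ˣ) :
        Module.End ℂ Space) * (((u ^ (-((b + 1 : ℕ) : ℤ)) : (Module.End ℂ Space)ˣ) :
        Module.End ℂ Space) * (stringSign k * lower k) *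
        ((u ^ ((b + 1 : ℕ) : ℤ) : (Module.End ℂ Space)ˣ) : Module.End ℂ Space))) =
        lower k * (u : Module.End ℂ Space) ^ (b + 1) := by
      rw [mul_assoc, ← mul_assoc ((u ^ ((b + 1 : ℕ) : ℤ) : (Module.End ℂ Space)ˣ) :
        Module.End ℂ Space), ← Units.val_mul, ← zpow_add, add_neg_cancel, zpow_zero,
        Units.val_one, one_mul, ← mul_assoc, ← mul_assoc, stringSign_mul_stringSign, one_mul,
        zpow_natCast, Units.val_pow_eq_pow_val]
    rw [← Module.End.mul_apply, ← h3]
    exact h2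
  · exact mul_ne_zero (zpow_ne_zero _ hy0)
      (Finset.prod_ne_zero_iff.2 fun i _ => pow_ne_zero _ (by norm_num))

/-! ### Periodicity, zero and reflection of vacuum amplitudes -/

/-- Flipping all sites of a segment complements the configuration there. -/
theorem flipAll_apply (d j : ℕ) (f : Space) (σ : ℕ → Bool) :
    flipAll d j f σ = f (fun k => if j ≤ k ∧ k < j + d then !σ k else σ k) := by
  induction d generalizing j σ with
  | zero =>
    rw [flipAll, Module.End.one_apply]
    congr 1
    funext k
    rw [if_neg (by omega)]
  | succ d ih =>
    rw [flipAll, Module.End.mul_apply, flip_apply, ih]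
    congr 1
    funext k
    rcases eq_or_ne k j with rfl | hk
    · simp
    · rw [update_of_ne hk]
      refine if_congr ?_ rfl rfl
      omega

/-- A row that is already filled passes nothing on. -/
theorem transfer_apply_of_filled (y : ℂ) (d j : ℕ) (f : Space) {σ : ℕ → Bool}
    (hσ : ∀ k, j ≤ k → k < j + d → σ k = true) :
    transfer y d j f σ = flipAll d j f σ := by
  induction d generalizing j σ with
  | zero => rfl
  | succ d ih =>
    have hj : σ j = true := hσ j le_rfl (by omega)
    rw [transfer, flipAll, Module.End.mul_apply, Module.End.mul_apply, step_apply, flip_apply,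
      ih, if_neg (by simp [hj]), add_zero]
    intro k h1 h2
    rw [update_of_ne (by omega)]
    exact hσ k (by omega) (by omega)

/-- The vacuum amplitude of `a` rows of length `b`. -/
noncomputable def amplitude (y : ℂ) (b a : ℕ) : ℂ :=
  (transfer y b 1 ^ a) vacuum (fun _ => false)

theorem amplitude_add {y : ℂ} (hy : y * y = -1) (b a : ℕ) :
    amplitude y b (a + (b + 1)) = amplitude y b (b + 1) * amplitude y b a := by
  rw [amplitude, pow_add, Module.End.mul_apply, transfer_pow_vacuum hy, map_smul,
    Space.smul_apply]
  rfl

theorem transfer_pow_mul_flipAll_mul_transfer_pow (y : ℂ) (b k : ℕ) :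
    transfer y b 1 ^ k * flipAll b 1 * transfer (-y) b 1 ^ k = flipAll b 1 := by
  induction k with
  | zero => simp
  | succ k ih =>
    rw [pow_succ, pow_succ']
    calc _ = transfer y b 1 ^ k * (transfer y b 1 * flipAll b 1 * transfer (-y) b 1) *
          transfer (-y) b 1 ^ k := by simp only [mul_assoc]
      _ = _ := by rw [transfer_mul_flipAll_mul_transfer, ih]

/-- The configuration of the filled segment `1, …, b`. -/
def filled (b : ℕ) : ℕ → Bool := fun k => decide (1 ≤ k ∧ k < 1 + b)

theorem flipAll_apply_false (b : ℕ) (f : Space) :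
    flipAll b 1 f (fun _ => false) = f (filled b) := by
  rw [flipAll_apply]
  congr 1

theorem transfer_apply_filled (y : ℂ) (b : ℕ) (f : Space) :
    transfer y b 1 f (filled b) = f (fun _ => false) := by
  rw [transfer_apply_of_filled _ _ _ _ fun k h1 h2 => by simp [filled, h1, h2], flipAll_apply]
  congr 1
  funext k
  by_cases h : 1 ≤ k ∧ k < 1 + b <;> simp [filled, h]

theorem transfer_flipAll_vacuum (y : ℂ) (d j : ℕ) :
    transfer y d j (flipAll d j vacuum) = vacuum := by
  induction d generalizing j with
  | zero => rfl
  | succ d ih =>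
    have h : Commute (flip j) (transfer y d (j + 1)) := siteOp_commute_transfer (by omega) _ _
    rw [transfer, flipAll, Module.End.mul_apply, Module.End.mul_apply, ← Module.End.mul_apply
      (transfer y d (j + 1)), ← h.eq, Module.End.mul_apply, ih, ← Module.End.mul_apply, step,
      mul_assoc, flip_mul_flip, mul_one, LinearMap.add_apply, LinearMap.smul_apply,
      Module.End.mul_apply, lower_vacuum, map_zero, smul_zero, add_zero, Module.End.one_apply]

theorem transfer_pow_injective (y : ℂ) (b k : ℕ) :
    Function.Injective (transfer y b 1 ^ k : Module.End ℂ Space) := by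
  obtain ⟨u, hu⟩ := (isUnit_transfer y b 1).pow k
  rw [← hu]
  intro f g h
  have h1 := congrArg (fun f => ((u⁻¹ : (Module.End ℂ Space)ˣ) : Module.End ℂ Space) f) h
  simpa only [← Module.End.mul_apply, Units.inv_mul, Module.End.one_apply] using h1

theorem amplitude_self {y : ℂ} (hy : y * y = -1) {b : ℕ} (hb : 0 < b) : amplitude y b b = 0 := by
  -- T^b on the vacuum is c T⁻¹ on the vacuum, and T⁻¹ fills all sites.
  have h : (transfer y b 1 ^ b) vacuum = amplitude y b (b + 1) • flipAll b 1 vacuum := by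
    apply transfer_pow_injective y b 1
    rw [map_smul, pow_one, transfer_flipAll_vacuum, ← Module.End.mul_apply, ← pow_succ',
      transfer_pow_vacuum hy]
    rfl
  rw [amplitude, h, Space.smul_apply, flipAll_apply_false, vacuum, if_neg, mul_zero]
  intro h
  have := congrFun h 1
  simp [filled, hb] at this

/-- Reflection of the amplitudes. -/
theorem amplitude_reflect {y : ℂ} (hy : y * y = -1) {b a a' : ℕ} (h : a + a' + 1 = b) :
    amplitude y b a = amplitude y b (b + 1) * amplitude (-y) b a' := by
  -- T^a = T^(-(a'+2)) T^(b+1), with the negative power written through the flip. Of the a' + 2 rows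
  -- of weight -y, the first and last are then absorbed by the filled configurations at both ends.
  have h1 : (transfer y b 1 ^ a) vacuum = amplitude y b (b + 1) •
      flipAll b 1 ((transfer (-y) b 1 ^ (a' + 2)) (flipAll b 1 vacuum)) := by
    apply transfer_pow_injective y b (a' + 2)
    rw [map_smul]
    simp only [← Module.End.mul_apply]
    rw [← pow_add, show a' + 2 + a = b + 1 by omega, ← mul_assoc, ← mul_assoc,
      transfer_pow_mul_flipAll_mul_transfer_pow, flipAll_mul_flipAll, transfer_pow_vacuum hy]
    rfl
  rw [amplitude, h1, Space.smul_apply, flipAll_apply_false, pow_succ, Module.End.mul_apply,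
    transfer_flipAll_vacuum, pow_succ', Module.End.mul_apply, transfer_apply_filled]
  rfl

end SpinChain

/-! ### The transfer operator computes tiling sums -/

namespace DominoTilings

open Function SpinChain

/-- The board of `a` full rows of length `b`, the top one without the squares of `σ` to the left of
column `j`, and above it the squares outside of `σ` from column `j` on. -/
noncomputable def skyline (b a j : ℕ) (σ : ℕ → Bool) : Board :=
  (rect b (a + 1)).filter fun s => s.2 < a ∨ (s.2 = a ∧ ¬ (s.1 < j ∧ σ s.1.toNat = true)) ∨
    (s.2 = a + 1 ∧ j ≤ s.1 ∧ σ s.1.toNat = false)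

theorem mem_skyline {b a j : ℕ} {σ : ℕ → Bool} {k : ℕ} {r : ℤ} :
    ((k : ℤ), r) ∈ skyline b a j σ ↔ (1 ≤ k ∧ k ≤ b ∧ 1 ≤ r) ∧
      (r < a ∨ (r = a ∧ ¬ (k < j ∧ σ k = true)) ∨ (r = a + 1 ∧ j ≤ k ∧ σ k = false)) := by
  rw [skyline, Finset.mem_filter, mem_rect]
  simp only [Int.toNat_natCast]
  cases σ k <;> simp <;> omega

theorem skyline_nonneg {b a j : ℕ} {σ : ℕ → Bool} {i r : ℤ} (h : (i, r) ∈ skyline b a j σ) :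
    0 ≤ i := by
  rw [skyline, Finset.mem_filter, mem_rect] at h
  omega

theorem board_ext {X Y : Board} (hX : ∀ i r, (i, r) ∈ X → 0 ≤ i) (hY : ∀ i r, (i, r) ∈ Y → 0 ≤ i)
    (h : ∀ (k : ℕ) (r : ℤ), ((k : ℤ), r) ∈ X ↔ ((k : ℤ), r) ∈ Y) : X = Y := by
  ext ⟨i, r⟩
  by_cases hi : 0 ≤ i
  · lift i to ℕ using hi
    exact h i r
  · exact ⟨fun h => absurd (hX _ _ h) hi, fun h => absurd (hY _ _ h) hi⟩

theorem skyline_ext {b a j a' j' : ℕ} {σ τ : ℕ → Bool}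
    (h : ∀ (k : ℕ) (r : ℤ), ((k : ℤ), r) ∈ skyline b a j σ ↔ ((k : ℤ), r) ∈ skyline b a' j' τ) :
    skyline b a j σ = skyline b a' j' τ :=
  board_ext (fun _ _ => skyline_nonneg) (fun _ _ => skyline_nonneg) h

theorem skyline_sdiff_ext {b a j a' j' : ℕ} {σ τ : ℕ → Bool} {d : Finset (ℤ × ℤ)}
    (h : ∀ (k : ℕ) (r : ℤ),
      ((k : ℤ), r) ∈ skyline b a j σ \ d ↔ ((k : ℤ), r) ∈ skyline b a' j' τ) :
    skyline b a j σ \ d = skyline b a' j' τ :=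
  board_ext (fun _ _ h => skyline_nonneg (Finset.mem_sdiff.1 h).1) (fun _ _ => skyline_nonneg) h

theorem skyline_of_filled {b a j : ℕ} {σ : ℕ → Bool} (h : σ j = true) :
    skyline b a j σ = skyline b a (j + 1) (update σ j false) := by
  refine skyline_ext fun k r => ?_
  rw [mem_skyline, mem_skyline]
  rcases eq_or_ne k j with rfl | hk
  · simp [h]
  · rw [update_of_ne hk]
    cases σ k <;> simp <;> omega

theorem skyline_sdiff_vertical {b a j : ℕ} {σ : ℕ → Bool} (h : σ j = false) :
    skyline b a j σ \ {((j : ℤ), (a : ℤ) + 1 - 1), ((j : ℤ), (a : ℤ) + 1)} =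
      skyline b a (j + 1) (update σ j true) := by
  refine skyline_sdiff_ext fun k r => ?_
  rw [Finset.mem_sdiff, mem_skyline, mem_skyline]
  simp only [Finset.mem_insert, Finset.mem_singleton, Prod.mk.injEq, Nat.cast_inj]
  rcases eq_or_ne k j with rfl | hk
  · simp [h]
    omega
  · rw [update_of_ne hk]
    cases σ k <;> simp <;> omega

theorem skyline_sdiff_horizontal {b a j : ℕ} {σ : ℕ → Bool} (h : σ j = false)
    (h' : σ (j + 1) = false) :
    skyline b a j σ \ {((j : ℤ), (a : ℤ) + 1), ((j : ℤ) + 1, (a : ℤ) + 1)} =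
      skyline b a (j + 1) (update σ (j + 1) true) := by
  refine skyline_sdiff_ext fun k r => ?_
  rw [Finset.mem_sdiff, mem_skyline, mem_skyline]
  simp only [Finset.mem_insert, Finset.mem_singleton, Prod.mk.injEq, Nat.cast_inj]
  norm_cast
  rcases eq_or_ne k (j + 1) with rfl | hk
  · simp [h']
    omega
  · rw [update_of_ne hk]
    rcases eq_or_ne k j with rfl | hk'
    · simp [h]
      omega
    · cases σ k <;> simp <;> omega

/-- The weighted tiling sum of a skyline; zero if it would have to leave the half plane. -/
noncomputable def skylineSum (y : ℂ) (b a j : ℕ) (σ : ℕ → Bool) : ℂ :=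
  open Classical in
  if a = 0 ∧ ∃ k < j, σ k = true then 0 else weightedTilingSum y (skyline b a j σ)

theorem skylineSum_of_filled (y : ℂ) {b a j : ℕ} {σ : ℕ → Bool} (h : σ j = true) :
    skylineSum y b a j σ = skylineSum y b a (j + 1) (update σ j false) := by
  rw [skylineSum, skylineSum, skyline_of_filled h]
  refine if_congr (and_congr_right fun _ => ⟨?_, ?_⟩) rfl rfl
  · rintro ⟨k, hk, hσ⟩
    exact ⟨k, by omega, by rwa [update_of_ne (by omega)]⟩
  · rintro ⟨k, hk, hσ⟩
    rcases eq_or_ne k j with rfl | hne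
    · simp at hσ
    · rw [update_of_ne hne] at hσ
      exact ⟨k, by omega, hσ⟩

/-- The square in column `j` of the partial top row has no left or upper neighbour, so the corner
expansion applies. -/
theorem weightedTilingSum_skyline (y : ℂ) {b a j : ℕ} (hj : 1 ≤ j) (hjb : j ≤ b) {σ : ℕ → Bool}
    (h : σ j = false) :
    weightedTilingSum y (skyline b a j σ) =
      (if j < b ∧ σ (j + 1) = false then
        y * weightedTilingSum y (skyline b a (j + 1) (update σ (j + 1) true)) else 0) +
      (if a = 0 then 0 else weightedTilingSum y (skyline b a (j + 1) (update σ j true))) := by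
  have hr : ((j : ℤ) + 1, (a : ℤ) + 1) ∈ skyline b a j σ ↔ j < b ∧ σ (j + 1) = false := by
    have := mem_skyline (b := b) (a := a) (j := j) (σ := σ) (k := j + 1) (r := a + 1)
    push_cast at this
    rw [this]
    cases σ (j + 1) <;> simp
  have hd : ((j : ℤ), (a : ℤ) + 1 - 1) ∈ skyline b a j σ ↔ ¬ a = 0 := by
    rw [mem_skyline]
    simp
    omega
  have hl : ((j : ℤ) - 1, (a : ℤ) + 1) ∉ skyline b a j σ := by
    rw [skyline, Finset.mem_filter]
    rintro ⟨-, h⟩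
    simp only at h
    omega
  have hu : ((j : ℤ), (a : ℤ) + 1 + 1) ∉ skyline b a j σ := by
    rw [mem_skyline]
    omega
  have hs : ((j : ℤ), (a : ℤ) + 1) ∈ skyline b a j σ := by
    rw [mem_skyline]
    simp [h]
    omega
  rw [weightedTilingSum_expand y hs hl hu, skyline_sdiff_vertical h]
  congr 1
  · by_cases h1 : j < b ∧ σ (j + 1) = false
    · rw [if_pos h1, if_pos (hr.2 h1), skyline_sdiff_horizontal h h1.2]
    · rw [if_neg h1, if_neg (mt hr.1 h1)]
  · by_cases h1 : a = 0
    · rw [if_pos h1, if_neg (fun h2 => hd.1 h2 h1)]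
    · rw [if_neg h1, if_pos (hd.2 h1)]

/-- For `a = 0` the board cannot record a square removed from row 0. The default value 0 of
`skylineSum` discards that vertical domino and keeps the recursion uniform in `a`. -/
theorem skylineSum_of_empty (y : ℂ) {b a j : ℕ} (hj : 1 ≤ j) (hjb : j ≤ b) {σ : ℕ → Bool}
    (h : σ j = false) :
    skylineSum y b a j σ = skylineSum y b a (j + 1) (update σ j true) +
      if j < b ∧ σ (j + 1) = false then
        y * skylineSum y b a (j + 1) (update σ (j + 1) true) else 0 := by
  have hV : skylineSum y b a (j + 1) (update σ j true) =
      if a = 0 then 0 else weightedTilingSum y (skyline b a (j + 1) (update σ j true)) := by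
    rw [skylineSum]
    refine if_congr (and_iff_left ⟨j, by omega, by simp⟩) rfl rfl
  have hH : skylineSum y b a (j + 1) (update σ (j + 1) true) =
      if a = 0 ∧ ∃ k < j, σ k = true then 0 else
        weightedTilingSum y (skyline b a (j + 1) (update σ (j + 1) true)) := by
    rw [skylineSum]
    refine if_congr (and_congr_right fun _ => ⟨?_, ?_⟩) rfl rfl
    · rintro ⟨k, hk, hσ⟩
      rw [update_of_ne (by omega)] at hσ
      refine ⟨k, lt_of_le_of_ne (by omega) ?_, hσ⟩
      rintro rfl
      simp [h] at hσ
    · rintro ⟨k, hk, hσ⟩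
      exact ⟨k, by omega, by rwa [update_of_ne (by omega)]⟩
  rw [hV, hH, skylineSum]
  by_cases h0 : a = 0 ∧ ∃ k < j, σ k = true
  · simp [h0.1, h0.2]
  rw [if_neg h0, if_neg h0, weightedTilingSum_skyline y hj hjb h, add_comm]

theorem transfer_apply_eq_skylineSum {y : ℂ} {b a : ℕ} {f : Space}
    (hf : ∀ σ : ℕ → Bool, (∀ k, σ k = true → 1 ≤ k ∧ k ≤ b) → f σ = skylineSum y b a (b + 1) σ)
    {d j : ℕ} (hj : 1 ≤ j) (hd : j + d = b + 1) {σ : ℕ → Bool}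
    (hσ : ∀ k, σ k = true → 1 ≤ k ∧ k ≤ b) :
    transfer y d j f σ = skylineSum y b a j σ := by
  induction d generalizing j σ with
  | zero =>
    obtain rfl : j = b + 1 := by omega
    exact hf σ hσ
  | succ d ih =>
    have hupd : ∀ i c, 1 ≤ i ∧ i ≤ b → ∀ k, update σ i c k = true → 1 ≤ k ∧ k ≤ b := by
      intro i c hi k hk
      rcases eq_or_ne k i with rfl | hne
      · exact hi
      · rw [update_of_ne hne] at hk
        exact hσ k hk
    rw [transfer, Module.End.mul_apply, step_apply,
      ih (by omega) (by omega) (hupd _ _ (by omega))]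
    cases h : σ j with
    | true => simp [skylineSum_of_filled y h]
    | false =>
      rw [skylineSum_of_empty y hj (by omega) h]
      congr 1
      rcases Nat.eq_zero_or_pos d with rfl | hpos
      · rw [if_neg (show ¬ (j < b ∧ _) by omega)]
        simp
      · rw [if_neg (by omega : ¬ d = 0), ih (by omega) (by omega) (hupd _ _ (by omega))]
        refine if_congr ?_ rfl rfl
        have : j < b := by omega
        simp [this]

theorem skylineSum_next_row (y : ℂ) (b a : ℕ) {σ : ℕ → Bool}
    (hσ : ∀ k, σ k = true → 1 ≤ k ∧ k ≤ b) :
    skylineSum y b a 1 σ = skylineSum y b (a + 1) (b + 1) σ := by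
  rw [skylineSum, skylineSum, if_neg, if_neg (by omega)]
  · congr 1
    refine board_ext (fun _ _ => skyline_nonneg) (fun _ _ => skyline_nonneg) fun k r => ?_
    rw [mem_skyline, mem_skyline]
    push_cast
    cases σ k <;> simp <;> omega
  · rintro ⟨-, k, hk, h⟩
    have := hσ k h
    omega

theorem transfer_pow_vacuum_apply (y : ℂ) (b a : ℕ) {σ : ℕ → Bool}
    (hσ : ∀ k, σ k = true → 1 ≤ k ∧ k ≤ b) :
    (transfer y b 1 ^ a) vacuum σ = skylineSum y b a (b + 1) σ := by
  induction a generalizing σ with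
  | zero =>
    rw [pow_zero, Module.End.one_apply, vacuum, skylineSum]
    by_cases h : σ = fun _ => false
    · subst h
      rw [if_pos rfl, if_neg (by simp), skyline, Finset.filter_false_of_mem,
        weightedTilingSum_empty]
      rintro ⟨i, r⟩ hs
      rw [mem_rect] at hs
      push_cast at hs ⊢
      omega
    · rw [if_neg h, if_pos]
      obtain ⟨k, hk⟩ : ∃ k, σ k = true := by
        by_contra! hc
        exact h (funext fun k => by simpa using hc k)
      exact ⟨rfl, k, by have := hσ k hk; omega, hk⟩
  | succ a ih =>
    rw [pow_succ', Module.End.mul_apply,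
      transfer_apply_eq_skylineSum (fun σ hσ => ih hσ) le_rfl (by omega) hσ,
      skylineSum_next_row y b a hσ]

/-- The weighted tiling sum of a rectangle is a vacuum amplitude of the spin chain. -/
theorem amplitude_eq_weightedTilingSum (y : ℂ) (b a : ℕ) :
    amplitude y b a = weightedTilingSum y (rect b a) := by
  rw [amplitude, transfer_pow_vacuum_apply y b a (by simp), skylineSum, if_neg (by simp)]
  congr 1
  refine board_ext (fun _ _ => skyline_nonneg) (fun i r h => ?_) fun k r => ?_
  · rw [mem_rect] at h
    omega
  · rw [mem_skyline, mem_rect]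
    simp
    omega

/-! ### Parity of the number of horizontal dominoes -/

theorem sum_odd_Icc (N : ℕ) :
    ∑ i ∈ Finset.Icc (1 : ℤ) ((2 * N : ℕ) : ℤ), (if Odd i then 1 else 0) = N := by
  induction N with
  | zero => simp
  | succ N ih =>
    have h : Finset.Icc (1 : ℤ) ((2 * (N + 1) : ℕ) : ℤ) =
        insert (2 * N + 1 : ℤ) (insert (2 * N + 2 : ℤ) (Finset.Icc (1 : ℤ) ((2 * N : ℕ) : ℤ))) := by
      ext i
      simp only [Finset.mem_insert, Finset.mem_Icc]
      push_cast
      omega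
    have h1 : Odd (2 * N + 1 : ℤ) := ⟨N, rfl⟩
    have h2 : ¬ Odd (2 * N + 2 : ℤ) := by
      rw [Int.not_odd_iff_even]
      exact ⟨N + 1, by ring⟩
    rw [h, Finset.sum_insert, Finset.sum_insert, ih, if_pos h1, if_neg h2]
    · omega
    all_goals
      simp only [Finset.mem_insert, Finset.mem_Icc]
      push_cast
      omega

/-- The parity of the number of horizontal dominoes does not depend on the tiling. -/
theorem even_numHorizontal_add {N a : ℕ} {D : Finset (Finset (ℤ × ℤ))}
    (hD : IsDominoTiling (rect (2 * N) a) D) : Even (numHorizontal D + N * a) := by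
  classical
  have h := hD.sum_eq fun s => if Odd s.1 then 1 else 0
  have hrect : ∑ s ∈ rect (2 * N) a, (if Odd s.1 then 1 else 0) = N * a := by
    rw [rect, Finset.sum_product_right]
    refine (Finset.sum_congr rfl fun _ _ => sum_odd_Icc N).trans ?_
    simp [mul_comm]
  rw [hrect] at h
  have hnum : numHorizontal D = ∑ d ∈ D, if IsHorizontal d then 1 else 0 := by
    rw [numHorizontal, Finset.card_filter]
  rw [h, hnum, ← Finset.sum_add_distrib]
  -- A horizontal domino has one square in an odd column, a vertical one has none or two.
  refine Finset.even_sum _ fun d hd => ?_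
  rcases (hD.1 d hd).2 with hh | hv
  · rw [if_pos hh]
    obtain ⟨i, j, rfl⟩ := hh
    rw [Finset.sum_pair (by simp)]
    rcases Int.even_or_odd i with hi | hi
    · rw [if_neg (Int.not_odd_iff_even.2 hi), if_pos hi.add_one]
      exact even_two
    · rw [if_pos hi, if_neg (Int.not_odd_iff_even.2 hi.add_one)]
      exact even_two
  · rw [if_neg (not_isHorizontal_of_isVertical hv)]
    obtain ⟨i, j, rfl⟩ := hv
    rw [Finset.sum_pair (by simp), zero_add]
    exact ⟨_, rfl⟩

theorem weightedTilingSum_neg (y : ℂ) (N a : ℕ) :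
    weightedTilingSum (-y) (rect (2 * N) a) =
      (-1) ^ (N * a) * weightedTilingSum y (rect (2 * N) a) := by
  rw [weightedTilingSum, weightedTilingSum, Finset.mul_sum]
  refine Finset.sum_congr rfl fun D hD => ?_
  have h := even_numHorizontal_add (mem_dominoTilings.1 hD)
  rw [neg_pow]
  congr 1
  have h1 : (-1 : ℂ) ^ numHorizontal D * (-1) ^ (N * a) = 1 := by
    rw [← pow_add]
    exact h.neg_one_pow
  have h2 : (-1 : ℂ) ^ (N * a) * (-1) ^ (N * a) = 1 := by rw [← mul_pow]; simp
  calc (-1 : ℂ) ^ numHorizontal D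
      = (-1 : ℂ) ^ numHorizontal D * ((-1) ^ (N * a) * (-1) ^ (N * a)) := by
        rw [h2, mul_one]
    _ = _ := by rw [← mul_assoc, h1, one_mul]

end DominoTilings

/-! ### Comparison with the Jacobi symbol -/

namespace DominoTilings

open SpinChain Complex

theorem signedTilingSum_rect_swap (N a : ℕ) :
    signedTilingSum (rect a (2 * N)) = (-I) ^ (N * a) * signedTilingSum (rect (2 * N) a) := by
  have h := weightedTilingSum_transpose I_ne_zero (rect a (2 * N)) (k := N * a)
    (by rw [card_rect]; ring)
  rw [transpose_rect, inv_I, weightedTilingSum_neg, ← mul_assoc, ← mul_pow, mul_neg_one] at h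
  exact h

theorem signedTilingSum_rect_eq_amplitude (N a : ℕ) :
    signedTilingSum (rect a (2 * N)) = (-I) ^ (N * a) * amplitude I (2 * N) a := by
  rw [signedTilingSum_rect_swap, amplitude_eq_weightedTilingSum]
  rfl

theorem signedTilingSum_rect_zero_left (b : ℕ) : signedTilingSum (rect 0 b) = 1 := by
  have h : rect 0 b = ∅ := by simp [rect]
  rw [h]
  exact weightedTilingSum_empty I

theorem signedTilingSum_rect_zero_right (a : ℕ) : signedTilingSum (rect a 0) = 1 :=
  weightedTilingSum_rect_zero_right I a

theorem signedTilingSum_rect_add (N a : ℕ) :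
    signedTilingSum (rect (a + (2 * N + 1)) (2 * N)) =
      signedTilingSum (rect (2 * N + 1) (2 * N)) * signedTilingSum (rect a (2 * N)) := by
  rw [signedTilingSum_rect_eq_amplitude, signedTilingSum_rect_eq_amplitude,
    signedTilingSum_rect_eq_amplitude, amplitude_add I_mul_I]
  ring

theorem signedTilingSum_rect_reflect {N a a' : ℕ} (h : a + a' + 1 = 2 * N) :
    signedTilingSum (rect a (2 * N)) =
      signedTilingSum (rect (2 * N + 1) (2 * N)) * (-1) ^ N *
        signedTilingSum (rect a' (2 * N)) := by
  rw [signedTilingSum_rect_eq_amplitude, signedTilingSum_rect_eq_amplitude,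
    signedTilingSum_rect_eq_amplitude, amplitude_reflect I_mul_I h,
    amplitude_eq_weightedTilingSum (-I), weightedTilingSum_neg,
    ← amplitude_eq_weightedTilingSum]
  have h1 : (-1 : ℂ) = (-I) ^ 2 := by simp
  have h4 : (-I) ^ 4 = 1 := by
    rw [show 4 = 2 * 2 by rfl, pow_mul, ← h1]
    norm_num
  have key : (-I) ^ (N * a) * (-1) ^ (N * a') =
      (-I) ^ (N * (2 * N + 1)) * (-1) ^ N * (-I) ^ (N * a') := by
    -- All signs are powers of -I, so it suffices that the exponents agree modulo 4.
    have e : N * (2 * N + 1) + 2 * N + N * a' = N * a + 2 * (N * a') + 4 * N := by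
      rw [show 2 * N + 1 = a + a' + 2 by omega]; ring
    rw [h1, ← pow_mul, ← pow_mul, ← pow_add, ← pow_add, ← pow_add, e, pow_add _ _ (4 * N),
      pow_mul _ 4, h4, one_pow, mul_one]
  linear_combination amplitude I (2 * N) (2 * N + 1) * amplitude I (2 * N) a' * key

theorem signedTilingSum_rect_self {N : ℕ} (hN : 0 < N) :
    signedTilingSum (rect (2 * N) (2 * N)) = 0 := by
  rw [signedTilingSum_rect_eq_amplitude, amplitude_self I_mul_I (by omega), mul_zero]

/-- Reflecting width 0 to width 2N - 1 and back returns the value 1 multiplied by c². -/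
theorem signedTilingSum_period_sq {N : ℕ} (hN : 0 < N) :
    signedTilingSum (rect (2 * N + 1) (2 * N)) * signedTilingSum (rect (2 * N + 1) (2 * N)) =
      1 := by
  have h1 := signedTilingSum_rect_reflect (N := N) (a := 0) (a' := 2 * N - 1) (by omega)
  have h2 := signedTilingSum_rect_reflect (N := N) (a := 2 * N - 1) (a' := 0) (by omega)
  have hs : (-1 : ℂ) ^ N * (-1) ^ N = 1 := by rw [← mul_pow]; simp
  rw [h2, signedTilingSum_rect_zero_left] at h1
  linear_combination -h1 - signedTilingSum (rect (2 * N + 1) (2 * N)) ^ 2 * hs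

theorem signedTilingSum_rect_comm (M N : ℕ) :
    signedTilingSum (rect (2 * M) (2 * N)) =
      (-1) ^ (M * N) * signedTilingSum (rect (2 * N) (2 * M)) := by
  rw [signedTilingSum_rect_swap, show N * (2 * M) = 2 * (M * N) by ring, pow_mul]
  simp

theorem signedTilingSum_even_of_lt {M N : ℕ} (hN : 0 < N) (hNM : N ≤ M)
    (ih : ∀ K < M, signedTilingSum (rect (2 * K) (2 * N)) =
      jacobiSym ((2 * K + 1 : ℕ) : ℤ) (2 * N + 1)) :
    signedTilingSum (rect (2 * M) (2 * N)) =
      jacobiSym ((2 * M + 1 : ℕ) : ℤ) (2 * N + 1) := by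
  have hsq := signedTilingSum_period_sq hN
  rcases hNM.eq_or_lt with rfl | hlt
  · rw [signedTilingSum_rect_self hN, (jacobiSym.eq_zero_iff_not_coprime).2]
    · simp
    · simp
      omega
  -- With n = 2N + 1: for M ≥ n, two periods lower the numerator 2M + 1 by 2n. Otherwise one period
  -- and a reflection replace it by 2n - (2M + 1), with the factor (-1)^N = (-1/n); this is smaller
  -- since N < M.
  by_cases h2 : 2 * N + 1 ≤ M
  · obtain ⟨K, rfl⟩ : ∃ K, M = K + (2 * N + 1) := ⟨M - (2 * N + 1), by omega⟩
    rw [show 2 * (K + (2 * N + 1)) = 2 * K + (2 * N + 1) + (2 * N + 1) by ring,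
      signedTilingSum_rect_add, signedTilingSum_rect_add, ← mul_assoc, hsq, one_mul,
      ih K (by omega)]
    congr 1
    rw [jacobiSym.mod_left, jacobiSym.mod_left ((2 * K + (2 * N + 1) + (2 * N + 1) + 1 : ℕ) : ℤ)]
    congr 1
    push_cast
    rw [show (2 * K + (2 * N + 1) + (2 * N + 1) + 1 : ℤ) = 2 * K + 1 + (2 * N + 1) * 2 by ring,
      Int.add_mul_emod_self_left]
  · have hc : 2 * M = (2 * M - (2 * N + 1)) + (2 * N + 1) := by omega
    have hr := signedTilingSum_rect_reflect (N := N) (a := 2 * M - (2 * N + 1))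
      (a' := 2 * (2 * N - M)) (by omega)
    rw [hc, signedTilingSum_rect_add, hr, ih _ (by omega), ← hc, ← mul_assoc, ← mul_assoc, hsq,
      one_mul]
    have hJ : jacobiSym ((2 * M + 1 : ℕ) : ℤ) (2 * N + 1) =
        (-1) ^ N * jacobiSym ((2 * (2 * N - M) + 1 : ℕ) : ℤ) (2 * N + 1) := by
      have e : jacobiSym ((2 * M + 1 : ℕ) : ℤ) (2 * N + 1) =
          jacobiSym (-((2 * (2 * N - M) + 1 : ℕ) : ℤ)) (2 * N + 1) := by
        rw [jacobiSym.mod_left, jacobiSym.mod_left (-_)]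
        congr 1
        have : ((2 * M + 1 : ℕ) : ℤ) = -((2 * (2 * N - M) + 1 : ℕ) : ℤ) +
            ((2 * N + 1 : ℕ) : ℤ) * 2 := by omega
        rw [this, Int.add_mul_emod_self_left]
      rw [e, jacobiSym.neg _ ⟨N, rfl⟩, ZMod.χ₄_eq_neg_one_pow (by omega)]
      congr 2
      omega
    rw [hJ]
    push_cast
    rfl

/-- The signed tiling sum of a rectangle with both sides even. -/
theorem signedTilingSum_even (M N : ℕ) :
    signedTilingSum (rect (2 * M) (2 * N)) =
      jacobiSym ((2 * M + 1 : ℕ) : ℤ) (2 * N + 1) := by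
  induction hs : M + N using Nat.strong_induction_on generalizing M N with
  | _ s ih =>
    rcases Nat.eq_zero_or_pos N with rfl | hN
    · rw [mul_zero, signedTilingSum_rect_zero_right]
      simp
    rcases Nat.eq_zero_or_pos M with rfl | hM
    · rw [mul_zero, signedTilingSum_rect_zero_left]
      simp
    rcases le_or_gt N M with hNM | hMN
    · exact signedTilingSum_even_of_lt hN hNM fun K hK => ih _ (by omega) K N rfl
    · rw [signedTilingSum_rect_comm, signedTilingSum_even_of_lt hM hMN.le
        fun K hK => ih _ (by omega) K M rfl,
        jacobiSym.quadratic_reciprocity (a := 2 * M + 1) ⟨M, rfl⟩ ⟨N, rfl⟩,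
        show (2 * M + 1) / 2 = M by omega, show (2 * N + 1) / 2 = N by omega]
      push_cast
      rfl

/-- The signed tiling sum of a rectangle of odd width and even height. -/
theorem signedTilingSum_odd_even (K N : ℕ) :
    signedTilingSum (rect (2 * K + 1) (2 * N)) = jacobiSym ((K + 1 : ℕ) : ℤ) (2 * N + 1) := by
  rcases Nat.eq_zero_or_pos N with rfl | hN
  · rw [mul_zero, signedTilingSum_rect_zero_right]
    simp
  have hsq := signedTilingSum_period_sq hN
  -- One period makes the odd width even. The single column k = 0 then gives c = (2/n), which is
  -- cancelled from the general case.
  have hJ : ∀ k : ℕ, signedTilingSum (rect (2 * N + 1) (2 * N)) *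
      signedTilingSum (rect (2 * k + 1) (2 * N)) =
        jacobiSym (2 * (k + 1 : ℕ) : ℤ) (2 * N + 1) := fun k => by
    rw [← signedTilingSum_rect_add, show 2 * k + 1 + (2 * N + 1) = 2 * (k + N + 1) by ring,
      signedTilingSum_even]
    congr 1
    rw [jacobiSym.mod_left, jacobiSym.mod_left (2 * _)]
    congr 1
    push_cast
    rw [show (2 * (k + N + 1) + 1 : ℤ) = 2 * (k + 1) + (2 * N + 1) by ring, Int.add_emod_right]
  have hcol : signedTilingSum (rect (2 * 0 + 1) (2 * N)) = 1 := weightedTilingSum_column I N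
  have h2 := hJ 0
  rw [hcol, mul_one] at h2
  simp only [zero_add, Nat.cast_one, mul_one] at h2
  have hK := hJ K
  rw [h2, jacobiSym.mul_left 2, Int.cast_mul] at hK
  rw [h2] at hsq
  exact mul_left_cancel₀ (left_ne_zero_of_mul_eq_one hsq) hK

theorem signedTilingSum_eq_jacobiSym {m n : ℕ} (hm : 0 < m) (hn : Odd n) :
    signedTilingSum (rect (m - 1) (n - 1)) =
      if Odd m then ((jacobiSym (m : ℤ) n : ℤ) : ℂ)
      else ((jacobiSym ((m / 2 : ℕ) : ℤ) n : ℤ) : ℂ) := by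
  obtain ⟨N, rfl⟩ := hn
  split_ifs with h
  · obtain ⟨M, rfl⟩ := h
    exact signedTilingSum_even M N
  · obtain ⟨K, rfl⟩ := Nat.not_odd_iff_even.1 h
    obtain ⟨k, rfl⟩ : ∃ k, K = k + 1 := ⟨K - 1, by omega⟩
    rw [show k + 1 + (k + 1) - 1 = 2 * k + 1 by omega, show (k + 1 + (k + 1)) / 2 = k + 1 by omega]
    exact signedTilingSum_odd_even k N

theorem intCast_jacobiSym_mem (a : ℤ) (b : ℕ) :
    ((jacobiSym a b : ℤ) : ℂ) ∈ ({-1, 0, 1} : Set ℂ) := by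
  rcases jacobiSym.trichotomy a b with h | h | h <;> simp [h]

end DominoTilings

theorem theorem1p1 (m n : ℕ) (hm : 0 < m) (hn : Odd n) :
    -- the formula
    (DominoTilings.signedTilingSum (DominoTilings.rect (m - 1) (n - 1)) =
      if Odd m then ((jacobiSym (m : ℤ) n : ℤ) : ℂ)
      else ((jacobiSym ((m / 2 : ℕ) : ℤ) n : ℤ) : ℂ)) ∧
    -- the possible values
    DominoTilings.signedTilingSum (DominoTilings.rect (m - 1) (n - 1)) ∈ ({-1, 0, 1} : Set ℂ) ∧
    -- transposition and quadratic reciprocity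
    (Odd m →
      DominoTilings.signedTilingSum (DominoTilings.rect (m - 1) (n - 1)) =
        (-1 : ℂ) ^ ((m - 1) / 2 * ((n - 1) / 2)) *
          DominoTilings.signedTilingSum (DominoTilings.rect (n - 1) (m - 1)) ∧
      jacobiSym (m : ℤ) n = (-1) ^ ((m - 1) / 2 * ((n - 1) / 2)) * jacobiSym (n : ℤ) m) := by
  have h := DominoTilings.signedTilingSum_eq_jacobiSym hm hn
  refine ⟨h, ?_, fun hmo => ?_⟩
  · rw [h]
    split_ifs <;> exact DominoTilings.intCast_jacobiSym_mem _ _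
  · have hq := jacobiSym.quadratic_reciprocity hmo hn
    obtain ⟨M, rfl⟩ := hmo
    obtain ⟨N, rfl⟩ := hn
    simp only [Nat.add_sub_cancel, Nat.mul_div_cancel_left _ two_pos]
    rw [show (2 * M + 1) / 2 = M by omega, show (2 * N + 1) / 2 = N by omega] at hq
    exact ⟨DominoTilings.signedTilingSum_rect_comm M N, hq⟩
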